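/- Let $\mathbb{T}$ be a time scale (a nonempty closed subset of $\mathbb{R}$) with backward jump operator $\hat\rho(s)=\sup\{t\in\mathbb{T}: t<s\}$ (and $\hat\rho(\min\mathbb{T})=\min\mathbb{T}$ if the minimum exists) and nabla derivative $\hat\nabla$. A linear system of dimension $n$ on $\mathbb{T}$, $$y^{\hat\nabla}(s)=\bar A(s)y(s)+\bar B(s)v(s),\qquad \gamma(s)=\bar C(s)y(s),$$ has ld-continuous coefficients $\bar A(s)\in\mathbb{R}^{n\times n}$, $\bar B(s)\in\mathbb{R}^{n\times m}$, $\bar C(s)\in\mathbb{R}^{p\times n}$ and is solved backward in time; it is time-invariant if the coefficients are constant. Let $\Psi_{\bar A}(s,w)$, for $s\le w$ in $\mathbb{T}$, be its transition matrix: $s\mapsto\Psi_{\bar A}(s,w)$ is the backward solution of $Y^{\hat\nabla}=\bar A Y$ with $\Psi_{\bar A}(w,w)=I$. The system is a realization of the weighting pattern $\bar G$, a $p\times m$ matrix function of the pair $(s,z)$, if $$\bar G(s,z)=\bar C(s)\,\Psi_{\bar A}(s,\hat\rho(z))\,\bar B(z)\qquad\text{for all } s,z\in\mathbb{T},\ s\le\hat\rho(z).$$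 A realization of dimension $n$ is minimal if $\bar G$ has no realization, time-varying or time-invariant, of dimension $n'<n$ ($n'=0$ allowed). For $s_1<s_0$ in $\mathbb{T}$ the system is controllable on $[s_1,s_0]_{\mathbb{T}}=[s_1,s_0]\cap\mathbb{T}$ if for all states $y_0,y_1\in\mathbb{R}^n$ some piecewise ld-continuous control $v$ on $[s_1,s_0]_{\mathbb{T}}$ steers $y(s_0)=y_0$ to $y(s_1)=y_1$; it is observable on $[s_1,s_0]_{\mathbb{T}}$ if, for a known piecewise ld-continuous control, the state $y(s_0)$ is uniquely determined by the output $\gamma(s)$, $s\in(s_1,s_0]\cap\mathbb{T}$. **Theorem.** Let the time-invariant system with constant matrices $(\bar A,\bar B,\bar C)$, of dimension $n$, be a realization of the weighting pattern $\bar G$ on $\mathbb{T}$, where $\mathbb{T}$ has at least $\max(2,2n)$ points (for instance, $\mathbb{T}$ is infinite). No progressivity (invertibility of $I-\hat\nu(s)\bar A$, where $\hat\nu(s)=s-\hat\rho(s)$) is assumed. Then the realization is minimal if and only if there are $s_1<s_0$ in $\mathbb{T}$ such that the system is both controllable and observable on $[s_1,s_0]_{\mathbb{T}}$. The same equivalence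 holds if minimality is understood among time-invariant realizations of $\bar G$ only. -/

import Mathlib

open Filter Topology

namespace NablaControl

/-! A time scale is a nonempty closed set `T` of real numbers. -/

open Classical in
/-- The backward jump operator of `T`: `ρ(s) = sup {t ∈ T | t < s}`, and `ρ(s) = s` if no point
of `T` lies below `s`. -/
noncomputable def rho (T : Set ℝ) (s : ℝ) : ℝ :=
  if (T ∩ Set.Iio s).Nonempty then sSup (T ∩ Set.Iio s) else s

/-- `s` is left-dense in `T`: it is not the minimum of `T` and `ρ(s) = s`. -/
def LeftDense (T : Set ℝ) (s : ℝ) : Prop :=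
  (T ∩ Set.Iio s).Nonempty ∧ rho T s = s

/-- `f` has nabla derivative `L` at `s`, relative to the time scale `T`: for every `ε > 0`,
`|f(ρ(s)) - f(t) - L (ρ(s) - t)| ≤ ε |ρ(s) - t|` for all `t ∈ T` in a neighbourhood of `s`. -/
def HasNablaDeriv {E : Type*} [NormedAddCommGroup E] [NormedSpace ℝ E]
    (T : Set ℝ) (f : ℝ → E) (s : ℝ) (L : E) : Prop :=
  ∀ ε : ℝ, 0 < ε → ∀ᶠ t in 𝓝[T] s,
    ‖f (rho T s) - f t - (rho T s - t) • L‖ ≤ ε * |rho T s - t|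

/-- `f` is ld-continuous on `T`: continuous at the left-dense points, with (finite) right-sided
limits at the right-dense points (the second clause is void at all other points, where the
filter is trivial). -/
def LdContinuous {E : Type*} [TopologicalSpace E] (T : Set ℝ) (f : ℝ → E) : Prop :=
  ∀ s ∈ T, (LeftDense T s → ContinuousWithinAt f T s) ∧
    ∃ l : E, Tendsto f (𝓝[T ∩ Set.Ioi s] s) (𝓝 l)

/-- `f` is piecewise ld-continuous on `T`: regulated (one-sided limits exist at dense points),
and continuous at all left-dense points with finitely many exceptions. -/
def PiecewiseLdContinuous {E : Type*} [TopologicalSpace E] (T : Set ℝ) (f : ℝ → E) : Prop :=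
  (∀ s ∈ T, (∃ l : E, Tendsto f (𝓝[T ∩ Set.Iio s] s) (𝓝 l)) ∧
    ∃ l : E, Tendsto f (𝓝[T ∩ Set.Ioi s] s) (𝓝 l)) ∧
  {s : ℝ | s ∈ T ∧ LeftDense T s ∧ ¬ ContinuousWithinAt f T s}.Finite

/-- The data of a linear control system `y^∇ = A y + B v`, `γ = C y` with state in `ℝⁿ`, control
in `ℝᵐ` and output in `ℝᵖ`; the coefficients may depend on time. -/
structure LinSystem (n m p : ℕ) where
  A : ℝ → Matrix (Fin n) (Fin n) ℝ
  B : ℝ → Matrix (Fin n) (Fin m) ℝ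
  C : ℝ → Matrix (Fin p) (Fin n) ℝ

/-- The time-invariant system with constant coefficients `A`, `B`, `C`. -/
def LinSystem.const {n m p : ℕ} (A : Matrix (Fin n) (Fin n) ℝ) (B : Matrix (Fin n) (Fin m) ℝ)
    (C : Matrix (Fin p) (Fin n) ℝ) : LinSystem n m p where
  A := fun _ => A
  B := fun _ => B
  C := fun _ => C

/-- The coefficients of the system are ld-continuous on `T`. -/
def LinSystem.IsLdContinuous {n m p : ℕ} (T : Set ℝ) (Λ : LinSystem n m p) : Prop :=
  LdContinuous T Λ.A ∧ LdContinuous T Λ.B ∧ LdContinuous T Λ.C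

/-- `Ψ` is the backward transition matrix of `y^∇ = A y` on `T`: for each `w ∈ T`, the matrix
function `s ↦ Ψ(s, w)` on `{s ∈ T | s ≤ w}` is the (continuous) backward solution with
`Ψ(w, w) = I`. Derivatives are entrywise and relative to `{s ∈ T | s ≤ w}`; the equation is
imposed at every point that is not the minimum of `T` (a right-dense minimum, if there is one,
is reached by continuity). -/
def IsTransitionMatrix {n : ℕ} (T : Set ℝ) (A : ℝ → Matrix (Fin n) (Fin n) ℝ)
    (Ψ : ℝ → ℝ → Matrix (Fin n) (Fin n) ℝ) : Prop :=
  ∀ w ∈ T, Ψ w w = 1 ∧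
    ContinuousOn (fun s => Ψ s w) (T ∩ Set.Iic w) ∧
    ∀ s ∈ T, s ≤ w → (T ∩ Set.Iio s).Nonempty → ∀ i j : Fin n,
      HasNablaDeriv (T ∩ Set.Iic w) (fun r => Ψ r w i j) s ((A s * Ψ s w) i j)

/-- The system `Λ` (with ld-continuous coefficients) is a realization of the weighting pattern
`G` on `T`: `G(s, z) = C(s) Ψ(s, ρ(z)) B(z)` for all `s, z ∈ T` with `s ≤ ρ(z)`, where `Ψ` is the
transition matrix of `Λ`. Here `G s z` is the value of the pattern at `(s, z)`; the values of `G`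
at other arguments play no role. -/
def IsRealization {n m p : ℕ} (T : Set ℝ) (Λ : LinSystem n m p)
    (G : ℝ → ℝ → Matrix (Fin p) (Fin m) ℝ) : Prop :=
  Λ.IsLdContinuous T ∧
  ∃ Ψ : ℝ → ℝ → Matrix (Fin n) (Fin n) ℝ, IsTransitionMatrix T Λ.A Ψ ∧
    ∀ s ∈ T, ∀ z ∈ T, s ≤ rho T z → G s z = Λ.C s * Ψ s (rho T z) * Λ.B z

/-- `Λ` is a minimal realization of `G`: no system, time-varying or not, of smaller dimension
realizes `G`. -/
def IsMinimalRealization {n m p : ℕ} (T : Set ℝ) (Λ : LinSystem n m p)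
    (G : ℝ → ℝ → Matrix (Fin p) (Fin m) ℝ) : Prop :=
  IsRealization T Λ G ∧
    ∀ n' : ℕ, n' < n → ¬ ∃ Λ' : LinSystem n' m p, IsRealization T Λ' G

/-- `Λ` is minimal among time-invariant realizations of `G`: no time-invariant system of smaller
dimension realizes `G`. -/
def IsMinimalTimeInvariantRealization {n m p : ℕ} (T : Set ℝ) (Λ : LinSystem n m p)
    (G : ℝ → ℝ → Matrix (Fin p) (Fin m) ℝ) : Prop :=
  IsRealization T Λ G ∧
    ∀ n' : ℕ, n' < n → ¬ ∃ (A' : Matrix (Fin n') (Fin n') ℝ) (B' : Matrix (Fin n') (Fin m) ℝ)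
      (C' : Matrix (Fin p) (Fin n') ℝ), IsRealization T (LinSystem.const A' B' C') G

/-- `y` is a (backward) solution of `y^∇ = A y + B v` on `[s₁, s₀] ∩ T` for the control `v`: it is
continuous, and the equation holds at every point `s ≠ s₁` of `[s₁, s₀] ∩ T`, except at the
left-dense points at which the control is discontinuous. -/
def IsSolutionOn {n m p : ℕ} (T : Set ℝ) (Λ : LinSystem n m p) (s₁ s₀ : ℝ)
    (v : ℝ → Fin m → ℝ) (y : ℝ → Fin n → ℝ) : Prop :=
  ContinuousOn y (T ∩ Set.Icc s₁ s₀) ∧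
  ∀ s ∈ T, s₁ < s → s ≤ s₀ →
    (LeftDense T s → ContinuousWithinAt v (T ∩ Set.Icc s₁ s₀) s) →
    HasNablaDeriv (T ∩ Set.Icc s₁ s₀) y s ((Λ.A s).mulVec (y s) + (Λ.B s).mulVec (v s))

/-- Controllability on `[s₁, s₀] ∩ T`: any state at `s₀` can be steered to any state at `s₁` by a
piecewise ld-continuous control. -/
def ControllableOn {n m p : ℕ} (T : Set ℝ) (Λ : LinSystem n m p) (s₁ s₀ : ℝ) : Prop :=
  ∀ y₀ y₁ : Fin n → ℝ, ∃ (v : ℝ → Fin m → ℝ) (y : ℝ → Fin n → ℝ),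
    PiecewiseLdContinuous (T ∩ Set.Icc s₁ s₀) v ∧ IsSolutionOn T Λ s₁ s₀ v y ∧
      y s₀ = y₀ ∧ y s₁ = y₁

/-- Observability on `[s₁, s₀] ∩ T`: whatever the (known) control, the state at `s₀` is determined
uniquely by the output `γ = C y` on `(s₁, s₀] ∩ T`. -/
def ObservableOn {n m p : ℕ} (T : Set ℝ) (Λ : LinSystem n m p) (s₁ s₀ : ℝ) : Prop :=
  ∀ (v : ℝ → Fin m → ℝ) (y y' : ℝ → Fin n → ℝ),
    PiecewiseLdContinuous (T ∩ Set.Icc s₁ s₀) v →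
    IsSolutionOn T Λ s₁ s₀ v y → IsSolutionOn T Λ s₁ s₀ v y' →
    (∀ s ∈ T, s₁ < s → s ≤ s₀ → (Λ.C s).mulVec (y s) = (Λ.C s).mulVec (y' s)) →
    y s₀ = y' s₀

end NablaControl

/-! Everything passes through two algebraic conditions: `ObservablePair A C` and its transpose
`ControllablePair A B`.

If a pair fails, the system shrinks. The unobservable and the reachable subspace are invariant under
`A`, hence under the transition matrix, by uniqueness of backward solutions in a quotient space
(`mem_of_nablaDeriv_sub_mem`). Dividing by the former, or restricting to the latter, realizes the
same pattern in smaller dimension, again with constant coefficients. The same invariance shows that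
controllability and observability on one interval force both pairs.

The step from algebra back to time rests on `IsCocycle.mul_pow_mulVec_eq_zero`. Across a gap of
length `ν` the transition matrix is `1 - ν A`, and at a left-dense point this holds up to a
quadratic error. So if an output vanishes, its difference quotients give `C A ^ k x = 0` for
successive `k`, each power costing at most one point of `T`. By Cayley-Hamilton the powers `k < n`
suffice. Reflecting time and transposing gives the dual statement. Hence the pairs imply
observability and controllability on every interval with enough points; steering uses a Lebesgue
integral over the reals in place of a nabla integral.

If both pairs hold, no realization is smaller (`dimension_le_of_isRealization`): split `G(s, z) = (C
Ψ(s, w)) (Ψ(w, ρ(z)) B)` at a middle point `w`. The left factors are jointly injective on states and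
the right ones span the state space, so any state space through which the pattern factors has
dimension at least `n`. The bound covers time-varying competitors, while the shrunken systems are
time-invariant, so both notions of minimality agree. Solutions run only backward, so `1 - ν A` is
never inverted. -/

namespace NablaControl

/-! ### Backward jumps, gaps and induction on a time scale. -/

section Jump

variable {T : Set ℝ} {r s : ℝ}

theorem rho_of_gap (hr : r ∈ T) (hrs : r < s) (hgap : T ∩ Set.Ioo r s = ∅) : rho T s = r := by
  have hne : (T ∩ Set.Iio s).Nonempty := ⟨r, hr, hrs⟩
  rw [rho, if_pos hne]
  refine IsGreatest.csSup_eq ⟨⟨hr, hrs⟩, fun t ht => ?_⟩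
  by_contra! h
  exact (Set.eq_empty_iff_forall_notMem.1 hgap t) ⟨ht.1, h, ht.2⟩

theorem leftDense_of_forall_nonempty (h : ∀ r < s, (T ∩ Set.Ioo r s).Nonempty) :
    LeftDense T s := by
  obtain ⟨t, htT, ht⟩ := h (s - 1) (by linarith)
  have hne : (T ∩ Set.Iio s).Nonempty := ⟨t, htT, ht.2⟩
  refine ⟨hne, ?_⟩
  rw [rho, if_pos hne]
  refine csSup_eq_of_forall_le_of_forall_lt_exists_gt hne (fun t ht => ht.2.le) fun w hw => ?_
  obtain ⟨t, htT, ht⟩ := h w hw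
  exact ⟨t, ⟨htT, ht.2⟩, ht.1⟩

theorem LeftDense.nonempty_Ioo (h : LeftDense T s) : ∀ r < s, (T ∩ Set.Ioo r s).Nonempty := by
  intro r hr
  obtain ⟨hne, hs⟩ := h
  rw [rho, if_pos hne] at hs
  obtain ⟨t, ht, hrt⟩ := exists_lt_of_lt_csSup hne (hs.symm ▸ hr : r < sSup (T ∩ Set.Iio s))
  exact ⟨t, ht.1, hrt, ht.2⟩

theorem rho_le (T : Set ℝ) (s : ℝ) : rho T s ≤ s := by
  unfold rho
  split_ifs with h
  · exact csSup_le h fun t ht => ht.2.le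
  · exact le_rfl

theorem le_rho (hr : r ∈ T) (hrs : r < s) : r ≤ rho T s := by
  rw [rho, if_pos ⟨r, hr, hrs⟩]
  exact le_csSup ⟨s, fun t ht => ht.2.le⟩ ⟨hr, hrs⟩

theorem rho_mem (hT : IsClosed T) (hs : s ∈ T) : rho T s ∈ T := by
  unfold rho
  split_ifs with h
  · exact hT.closure_subset_iff.2 Set.inter_subset_left
      (csSup_mem_closure h ⟨s, fun t ht => ht.2.le⟩)
  · exact hs

theorem gap_rho (T : Set ℝ) (s : ℝ) : T ∩ Set.Ioo (rho T s) s = ∅ := by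
  rw [Set.eq_empty_iff_forall_notMem]
  rintro t ⟨ht, h1, h2⟩
  exact absurd (le_rho ht h2) (not_le.2 h1)

/-- Lets nabla derivatives be moved between `T` and its truncations. The bound `a < s` is strict
because truncation removes every point below `a`, which may change the jump at `a` itself. -/
theorem rho_inter_Icc {a b : ℝ} (ha : a ∈ T) (has : a < s) (hsb : s ≤ b) :
    rho (T ∩ Set.Icc a b) s = rho T s := by
  have hsub : T ∩ Set.Icc a b ∩ Set.Iio s ⊆ T ∩ Set.Iio s := fun t ht => ⟨ht.1.1, ht.2⟩
  have hne : (T ∩ Set.Icc a b ∩ Set.Iio s).Nonempty := ⟨a, ⟨ha, le_rfl, has.le.trans hsb⟩, has⟩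
  have hne' : (T ∩ Set.Iio s).Nonempty := hne.mono hsub
  have hbdd : BddAbove (T ∩ Set.Iio s) := ⟨s, fun t ht => ht.2.le⟩
  rw [rho, rho, if_pos hne, if_pos hne']
  refine le_antisymm (csSup_le_csSup hbdd hne hsub) (csSup_le hne' fun t ht => ?_)
  rcases le_total a t with h | h
  · exact le_csSup (hbdd.mono hsub) ⟨⟨ht.1, h, (Set.mem_Iio.1 ht.2).le.trans hsb⟩, ht.2⟩
  · exact h.trans (le_csSup (hbdd.mono hsub) ⟨⟨ha, le_rfl, has.le.trans hsb⟩, has⟩)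

theorem rho_inter_Iic {b : ℝ} (hsb : s ≤ b) : rho (T ∩ Set.Iic b) s = rho T s := by
  have : T ∩ Set.Iic b ∩ Set.Iio s = T ∩ Set.Iio s := by
    ext t
    simp only [Set.mem_inter_iff, Set.mem_Iic, Set.mem_Iio]
    constructor
    · rintro ⟨⟨h1, _⟩, h3⟩; exact ⟨h1, h3⟩
    · rintro ⟨h1, h3⟩; exact ⟨⟨h1, h3.le.trans hsb⟩, h3⟩
  rw [rho, rho, this]

theorem leftDense_inter_Icc_iff {a b : ℝ} (ha : a ∈ T) (has : a < s) (hsb : s ≤ b) :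
    LeftDense (T ∩ Set.Icc a b) s ↔ LeftDense T s := by
  unfold LeftDense
  rw [rho_inter_Icc ha has hsb]
  refine and_congr_left fun _ => ⟨fun _ => ⟨a, ha, has⟩, fun _ => ?_⟩
  exact ⟨a, ⟨ha, le_rfl, has.le.trans hsb⟩, has⟩

/-- Either `s` has an immediate predecessor in `T ∩ [a, s)`, or points of `T` accumulate at `s`
from the left. -/
theorem exists_gap_or_leftDense (hT : IsClosed T) {a : ℝ} (ha : a ∈ T) (has : a < s) :
    (∃ r ∈ T, a ≤ r ∧ r < s ∧ T ∩ Set.Ioo r s = ∅) ∨ ∀ r < s, (T ∩ Set.Ioo r s).Nonempty := by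
  by_cases h : ∀ r < s, (T ∩ Set.Ioo r s).Nonempty
  · exact Or.inr h
  · left
    push Not at h
    obtain ⟨r, hrs, hr⟩ := h
    have har : a ≤ r := by
      by_contra! h
      exact (Set.eq_empty_iff_forall_notMem.1 hr a) ⟨ha, h, has⟩
    obtain ⟨q, hq, hqmax⟩ := ((isCompact_Icc (a := a) (b := r)).inter_left hT).exists_isGreatest
      ⟨a, ha, le_rfl, har⟩
    refine ⟨q, hq.1, hq.2.1, hq.2.2.trans_lt hrs, ?_⟩
    rw [Set.eq_empty_iff_forall_notMem]
    rintro t ⟨ht, h1, h2⟩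
    rcases le_or_gt t r with h3 | h3
    · exact absurd (hqmax ⟨ht, (hq.2.1.trans h1.le), h3⟩) (not_le.2 h1)
    · exact (Set.eq_empty_iff_forall_notMem.1 hr t) ⟨ht, h3, h2⟩

/-- Induction on a time scale, downwards from `b` to `a`. -/
theorem backward_induction (hT : IsClosed T) {a b : ℝ} (ha : a ∈ T) (hb : b ∈ T) (hab : a ≤ b)
    {P : ℝ → Prop} (base : P b)
    (gap : ∀ s ∈ T, a < s → s ≤ b → ∀ r ∈ T, a ≤ r → r < s → T ∩ Set.Ioo r s = ∅ → P s → P r)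
    (left : ∀ s ∈ T, a < s → s ≤ b → (∀ r < s, (T ∩ Set.Ioo r s).Nonempty) → P s →
      ∃ r < s, ∀ t ∈ T, r < t → t < s → a ≤ t → P t)
    (right : ∀ s ∈ T, a ≤ s → s < b → (∀ r > s, (T ∩ Set.Ioo s r).Nonempty) →
      (∀ t ∈ T, s < t → t ≤ b → P t) → P s) : P a := by
  -- The infimum `c` of the points down to which `P` holds is shown to satisfy `P`; if `a < c`, then
  -- `gap` or `left` pushes `S` below its infimum.
  set S : Set ℝ := {s | s ∈ T ∧ a ≤ s ∧ s ≤ b ∧ ∀ t ∈ T, s ≤ t → t ≤ b → P t} with hS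
  have hbS : b ∈ S := ⟨hb, hab, le_rfl, fun t _ h1 h2 => le_antisymm h1 h2 ▸ base⟩
  have hbdd : BddBelow S := ⟨a, fun s hs => hs.2.1⟩
  set c := sInf S with hc
  have hcT : c ∈ T := hT.closure_subset_iff.2 (fun s hs => hs.1) (csInf_mem_closure ⟨b, hbS⟩ hbdd)
  have hac : a ≤ c := le_csInf ⟨b, hbS⟩ fun s hs => hs.2.1
  have hcb : c ≤ b := csInf_le hbdd hbS
  have above : ∀ t ∈ T, c < t → t ≤ b → P t := by
    intro t ht hct htb
    obtain ⟨s, hs, hst⟩ := exists_lt_of_csInf_lt ⟨b, hbS⟩ hct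
    exact hs.2.2.2 t ht hst.le htb
  have hPc : P c := by
    rcases hcb.eq_or_lt with h | h
    · exact h ▸ base
    by_cases hd : ∀ r > c, (T ∩ Set.Ioo c r).Nonempty
    · exact right c hcT hac h hd above
    · push Not at hd
      obtain ⟨r, hcr, hr⟩ := hd
      obtain ⟨s, hs, hsr⟩ := exists_lt_of_csInf_lt ⟨b, hbS⟩ hcr
      have hcs : c ≤ s := csInf_le hbdd hs
      rcases hcs.eq_or_lt with h' | h'
      · rw [h']; exact hs.2.2.2 s hs.1 le_rfl hs.2.2.1
      · exact absurd ⟨hs.1, h', hsr⟩ (Set.eq_empty_iff_forall_notMem.1 hr s)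
  have key : ∀ q ∈ T, a ≤ q → q < c → (∀ t ∈ T, q ≤ t → t < c → P t) → False := by
    intro q hq haq hqc h
    refine absurd (csInf_le hbdd (?_ : q ∈ S)) (not_le.2 hqc)
    refine ⟨hq, haq, hqc.le.trans hcb, fun t ht hqt htb => ?_⟩
    rcases lt_trichotomy t c with h' | h' | h'
    · exact h t ht hqt h'
    · exact h' ▸ hPc
    · exact above t ht h' htb
  rcases hac.eq_or_lt with h | hac'
  · exact h ▸ hPc
  exfalso
  rcases exists_gap_or_leftDense hT ha hac' with ⟨r, hrT, har, hrc, hr⟩ | hd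
  · refine key r hrT har hrc fun t ht hrt htc => ?_
    rcases hrt.eq_or_lt with h | h
    · exact h ▸ gap c hcT hac' hcb r hrT har hrc hr hPc
    · exact absurd ⟨ht, h, htc⟩ (Set.eq_empty_iff_forall_notMem.1 hr t)
  · obtain ⟨r, hrc, hr⟩ := left c hcT hac' hcb hd hPc
    obtain ⟨q, hqT, hq⟩ := hd (max r a) (max_lt hrc hac')
    refine key q hqT ((le_max_right _ _).trans hq.1.le) hq.2 fun t ht hqt htc => ?_
    exact hr t ht ((le_max_left _ _).trans_lt (hq.1.trans_le hqt)) htc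
      (((le_max_right _ _).trans hq.1.le).trans hqt)

end Jump

/-! ### Calculus of the nabla derivative. -/

section Deriv

variable {E F : Type*} [NormedAddCommGroup E] [NormedSpace ℝ E] [NormedAddCommGroup F]
  [NormedSpace ℝ F] {T : Set ℝ} {f g : ℝ → E} {s : ℝ} {L L' : E}

theorem hasNablaDeriv_iff_isLittleO : HasNablaDeriv T f s L ↔
    (fun t => f (rho T s) - f t - (rho T s - t) • L) =o[𝓝[T] s] fun t => rho T s - t := by
  simp only [HasNablaDeriv, Asymptotics.isLittleO_iff, Real.norm_eq_abs]

theorem HasNablaDeriv.clm_comp (h : HasNablaDeriv T f s L) (φ : E →L[ℝ] F) :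
    HasNablaDeriv T (fun t => φ (f t)) s (φ L) := by
  rw [hasNablaDeriv_iff_isLittleO] at h ⊢
  refine ((φ.isBigO_comp _ _).trans_isLittleO h).congr_left fun t => ?_
  simp

theorem HasNablaDeriv.add (h : HasNablaDeriv T f s L) (h' : HasNablaDeriv T g s L') :
    HasNablaDeriv T (fun t => f t + g t) s (L + L') := by
  rw [hasNablaDeriv_iff_isLittleO] at h h' ⊢
  refine (Asymptotics.IsLittleO.add h h').congr_left fun t => ?_
  simp only [smul_add]; abel

theorem HasNablaDeriv.sub (h : HasNablaDeriv T f s L) (h' : HasNablaDeriv T g s L') :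
    HasNablaDeriv T (fun t => f t - g t) s (L - L') := by
  rw [hasNablaDeriv_iff_isLittleO] at h h' ⊢
  refine (Asymptotics.IsLittleO.sub h h').congr_left fun t => ?_
  simp only [smul_sub]; abel

theorem HasNablaDeriv.sum {ι : Type*} {I : Finset ι} {f : ι → ℝ → E} {L : ι → E}
    (h : ∀ i ∈ I, HasNablaDeriv T (f i) s (L i)) :
    HasNablaDeriv T (fun t => ∑ i ∈ I, f i t) s (∑ i ∈ I, L i) := by
  simp only [hasNablaDeriv_iff_isLittleO] at h ⊢
  refine (Asymptotics.IsLittleO.sum h).congr_left fun t => ?_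
  simp only [Finset.sum_apply, Finset.sum_sub_distrib, Finset.smul_sum]

theorem hasNablaDeriv_const (c : E) : HasNablaDeriv T (fun _ => c) s 0 := by
  rw [hasNablaDeriv_iff_isLittleO]
  simp

theorem hasNablaDeriv_smul_const (c : E) : HasNablaDeriv T (fun t => t • c) s c := by
  rw [hasNablaDeriv_iff_isLittleO]
  simp [sub_smul]

theorem HasNablaDeriv.congr_deriv (h : HasNablaDeriv T f s L) (e : L = L') :
    HasNablaDeriv T f s L' := e ▸ h

theorem HasNablaDeriv.mono {S : Set ℝ} (h : HasNablaDeriv T f s L) (hST : S ⊆ T)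
    (hrho : rho S s = rho T s) : HasNablaDeriv S f s L := by
  rw [hasNablaDeriv_iff_isLittleO] at h ⊢
  rw [hrho]
  exact h.mono (nhdsWithin_mono _ hST)

theorem hasNablaDeriv_pi {ι : Type*} [Fintype ι] {f : ℝ → ι → ℝ} {L : ι → ℝ} :
    HasNablaDeriv T f s L ↔ ∀ i, HasNablaDeriv T (fun t => f t i) s (L i) := by
  simp only [hasNablaDeriv_iff_isLittleO]
  rw [Asymptotics.isLittleO_pi]
  rfl

/-- The choice `t = s` is admissible in the definition for every `ε`, so the error vanishes: across
a gap the equation is an exact backward Euler-type step with known right-hand side. -/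
theorem HasNablaDeriv.eq_of_rho_ne (h : HasNablaDeriv T f s L) (hs : s ∈ T) :
    f (rho T s) = f s - (s - rho T s) • L := by
  have key : ∀ ε : ℝ, 0 < ε → ‖f (rho T s) - f s - (rho T s - s) • L‖ ≤ ε * |rho T s - s| :=
    fun ε hε => (h ε hε).self_of_nhdsWithin hs
  have h0 : ‖f (rho T s) - f s - (rho T s - s) • L‖ ≤ 0 := by
    refine ge_of_tendsto (x := 𝓝[>] (0 : ℝ)) (f := fun ε : ℝ => ε * |rho T s - s|) ?_ ?_
    · have : Tendsto (fun ε : ℝ => ε * |rho T s - s|) (𝓝 0) (𝓝 (0 * |rho T s - s|)) :=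
        tendsto_id.mul_const _
      rw [zero_mul] at this
      exact this.mono_left nhdsWithin_le_nhds
    · filter_upwards [self_mem_nhdsWithin] with ε hε using key ε hε
  have h1 := norm_le_zero_iff.1 h0
  rw [sub_smul] at h1 ⊢
  rw [sub_sub, sub_eq_zero] at h1
  rw [h1]; abel

end Deriv

/-! ### Growth estimates, uniqueness and invariant subspaces for backward solutions. -/

section Comparison

variable {E : Type*} [NormedAddCommGroup E] [NormedSpace ℝ E] {T : Set ℝ} {f f' : ℝ → E}
  {a b : ℝ}

/-- A majorant `φ` that grows backward faster than `‖f‖` can. The slack `η` absorbs the error of the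
derivative at left-dense points, gaps are exact, and right-dense points follow by continuity. -/
theorem norm_le_of_comparison (hT : IsClosed T) (ha : a ∈ T) (hb : b ∈ T) (hab : a ≤ b)
    (hf : ContinuousOn f (T ∩ Set.Icc a b))
    (hd : ∀ s ∈ T, a < s → s ≤ b → HasNablaDeriv (T ∩ Set.Icc a b) f s (f' s))
    {φ : ℝ → ℝ} (hφ : Continuous φ)
    (hstep : ∀ s ∈ T, a < s → s ≤ b → ‖f s‖ ≤ φ s →
      ∃ η > 0, ∀ t, a ≤ t → t < s → φ s + (s - t) * (‖f' s‖ + η) ≤ φ t)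
    (hfb : ‖f b‖ ≤ φ b) : ‖f a‖ ≤ φ a := by
  refine backward_induction hT ha hb hab (P := fun s => ‖f s‖ ≤ φ s) hfb ?_ ?_ ?_
  · intro s hs has hsb r hr har hrs hgap hPs
    obtain ⟨η, hη, h⟩ := hstep s hs has hsb hPs
    have h1 := (hd s hs has hsb).eq_of_rho_ne ⟨hs, has.le, hsb⟩
    rw [rho_inter_Icc ha has hsb, rho_of_gap hr hrs hgap] at h1
    refine le_trans ?_ (h r har hrs)
    rw [h1]
    refine (norm_sub_le _ _).trans (add_le_add hPs ?_)
    rw [norm_smul, Real.norm_of_nonneg (by linarith)]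
    exact mul_le_mul_of_nonneg_left (by linarith) (by linarith)
  · intro s hs has hsb hld hPs
    obtain ⟨η, hη, h⟩ := hstep s hs has hsb hPs
    have h1 := hd s hs has hsb η hη
    rw [rho_inter_Icc ha has hsb, (leftDense_of_forall_nonempty hld).2] at h1
    rw [eventually_nhdsWithin_iff] at h1
    obtain ⟨r, hr, hr'⟩ := exists_Ioc_subset_of_mem_nhds h1 ⟨a, has⟩
    refine ⟨r, hr, fun t ht hrt hts hat => ?_⟩
    have h2 := hr' ⟨hrt, hts.le⟩ ⟨ht, hat, hts.le.trans hsb⟩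
    rw [abs_of_pos (by linarith)] at h2
    refine le_trans ?_ (h t hat hts)
    have h3 : f t = f s - (s - t) • f' s - (f s - f t - (s - t) • f' s) := by abel
    rw [h3]
    refine (norm_sub_le _ _).trans ?_
    have h4 : ‖f s - (s - t) • f' s‖ ≤ ‖f s‖ + (s - t) * ‖f' s‖ := by
      refine (norm_sub_le _ _).trans (add_le_add le_rfl ?_)
      rw [norm_smul, Real.norm_of_nonneg (by linarith)]
    have : (s - t) * (‖f' s‖ + η) = (s - t) * ‖f' s‖ + η * (s - t) := by ring
    linarith
  · intro s hs has hsb hrd h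
    have hne : (𝓝[T ∩ Set.Ioc s b] s).NeBot := by
      rw [← mem_closure_iff_nhdsWithin_neBot, Metric.mem_closure_iff]
      intro ε hε
      obtain ⟨t, ht, hst, htr⟩ := hrd (min b (s + ε)) (lt_min hsb (by linarith))
      refine ⟨t, ⟨ht, hst, (htr.trans_le (min_le_left _ _)).le⟩, ?_⟩
      rw [dist_comm, Real.dist_eq, abs_of_pos (by linarith)]
      linarith [htr.trans_le (min_le_right b (s + ε))]
    have hcf : ContinuousWithinAt f (T ∩ Set.Ioc s b) s :=
      (hf s ⟨hs, has, hsb.le⟩).mono fun t ht => ⟨ht.1, has.trans ht.2.1.le, ht.2.2⟩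
    refine le_of_tendsto_of_tendsto hcf.norm hφ.continuousWithinAt ?_
    filter_upwards [self_mem_nhdsWithin] with t ht using h t ht.1 ht.2.1 ht.2.2

/-- Grönwall's inequality, valid across gaps because `1 + x ≤ exp x`. -/
theorem norm_le_mul_exp (hT : IsClosed T) (ha : a ∈ T) (hb : b ∈ T) (hab : a ≤ b)
    (hf : ContinuousOn f (T ∩ Set.Icc a b))
    (hd : ∀ s ∈ T, a < s → s ≤ b → HasNablaDeriv (T ∩ Set.Icc a b) f s (f' s))
    {M : ℝ} (hM : 0 ≤ M) (hf' : ∀ s ∈ T, a < s → s ≤ b → ‖f' s‖ ≤ M * ‖f s‖) :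
    ‖f a‖ ≤ ‖f b‖ * Real.exp (M * (b - a)) := by
  have key : ∀ ε > 0, ‖f a‖ ≤ (‖f b‖ + ε) * Real.exp ((M + ε) * (b - a)) := by
    intro ε hε
    refine norm_le_of_comparison hT ha hb hab hf hd
      (φ := fun s => (‖f b‖ + ε) * Real.exp ((M + ε) * (b - s))) (by fun_prop) ?_ ?_
    · intro s hs has hsb hle
      -- The majorant is at least `ε` and its rate exceeds `M` by `ε`, which leaves a slack of `ε *
      -- ε`.
      refine ⟨ε * ε, by positivity, fun t hat hts => ?_⟩
      have hge : ε ≤ (‖f b‖ + ε) * Real.exp ((M + ε) * (b - s)) := by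
        have h1 : 1 ≤ Real.exp ((M + ε) * (b - s)) :=
          Real.one_le_exp (mul_nonneg (by linarith) (by linarith))
        nlinarith [norm_nonneg (f b)]
      set φs := (‖f b‖ + ε) * Real.exp ((M + ε) * (b - s)) with hφs
      have h2 : ‖f' s‖ + ε * ε ≤ (M + ε) * φs := by
        have := hf' s hs has hsb
        nlinarith [mul_le_mul_of_nonneg_left hle hM, mul_le_mul_of_nonneg_left hge hε.le]
      have h3 : (‖f b‖ + ε) * Real.exp ((M + ε) * (b - t)) =
          φs * Real.exp ((M + ε) * (s - t)) := by
        rw [hφs, mul_assoc, ← Real.exp_add]; ring_nf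
      rw [h3]
      have h4 := Real.add_one_le_exp ((M + ε) * (s - t))
      have h5 : φs * ((M + ε) * (s - t) + 1) ≤ φs * Real.exp ((M + ε) * (s - t)) :=
        mul_le_mul_of_nonneg_left h4 (by linarith)
      have h6 := mul_le_mul_of_nonneg_left h2 (by linarith : 0 ≤ s - t)
      linarith
    · simp [hε.le]
  refine ge_of_tendsto (x := 𝓝[>] (0 : ℝ))
    (f := fun ε : ℝ => (‖f b‖ + ε) * Real.exp ((M + ε) * (b - a))) ?_ ?_
  · have : Continuous fun ε : ℝ => (‖f b‖ + ε) * Real.exp ((M + ε) * (b - a)) := by fun_prop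
    have := this.tendsto 0
    simp only [add_zero] at this
    exact this.mono_left nhdsWithin_le_nhds
  · filter_upwards [self_mem_nhdsWithin] with ε hε using key ε hε

theorem norm_sub_le_of_nablaDeriv_le (hT : IsClosed T) (ha : a ∈ T) (hb : b ∈ T) (hab : a ≤ b)
    (hf : ContinuousOn f (T ∩ Set.Icc a b))
    (hd : ∀ s ∈ T, a < s → s ≤ b → HasNablaDeriv (T ∩ Set.Icc a b) f s (f' s))
    {K : ℝ} (hf' : ∀ s ∈ T, a < s → s ≤ b → ‖f' s‖ ≤ K) :
    ‖f a - f b‖ ≤ K * (b - a) := by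
  have key : ∀ ε > 0, ‖f a - f b‖ ≤ (K + ε) * (b - a) := by
    intro ε hε
    refine norm_le_of_comparison hT ha hb hab (f := fun s => f s - f b) (f' := f')
      (hf.sub continuousOn_const) (fun s hs has hsb => ?_)
      (φ := fun s => (K + ε) * (b - s)) (by fun_prop) ?_ (by simp)
    · simpa using (hd s hs has hsb).sub (hasNablaDeriv_const (f b))
    · intro s hs has hsb hle
      refine ⟨ε, hε, fun t hat hts => ?_⟩
      have := mul_le_mul_of_nonneg_left (hf' s hs has hsb) (by linarith : 0 ≤ s - t)
      linarith
  refine ge_of_tendsto (x := 𝓝[>] (0 : ℝ)) (f := fun ε : ℝ => (K + ε) * (b - a)) ?_ ?_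
  · have : Continuous fun ε : ℝ => (K + ε) * (b - a) := by fun_prop
    have := this.tendsto 0
    simp only [add_zero] at this
    exact this.mono_left nhdsWithin_le_nhds
  · filter_upwards [self_mem_nhdsWithin] with ε hε using key ε hε

theorem nhdsWithin_Iio_neBot {s c : ℝ} (hs : ∀ r < s, (T ∩ Set.Ioo r s).Nonempty) (hc : c < s) :
    (𝓝[T ∩ Set.Ioo c s] s).NeBot := by
  rw [← mem_closure_iff_nhdsWithin_neBot, Metric.mem_closure_iff]
  intro ε hε
  obtain ⟨t, ht, hst, htr⟩ := hs (max c (s - ε)) (max_lt hc (by linarith))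
  refine ⟨t, ⟨ht, (le_max_left _ _).trans_lt hst, htr⟩, ?_⟩
  rw [Real.dist_eq, abs_of_pos (by linarith)]
  linarith [(le_max_right c (s - ε)).trans_lt hst]

theorem nhdsWithin_Ioi_neBot {s c : ℝ} (hs : ∀ r > s, (T ∩ Set.Ioo s r).Nonempty) (hc : s < c) :
    (𝓝[T ∩ Set.Ioo s c] s).NeBot := by
  rw [← mem_closure_iff_nhdsWithin_neBot, Metric.mem_closure_iff]
  intro ε hε
  obtain ⟨t, ht, hst, htr⟩ := hs (min c (s + ε)) (lt_min hc (by linarith))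
  refine ⟨t, ⟨ht, hst, htr.trans_le (min_le_left _ _)⟩, ?_⟩
  rw [dist_comm, Real.dist_eq, abs_of_pos (by linarith)]
  linarith [htr.trans_le (min_le_right c (s + ε))]

/-- Backward uniqueness: the equation may fail at finitely many left-dense points. -/
theorem eq_zero_of_norm_nablaDeriv_le (hT : IsClosed T) (ha : a ∈ T) (hb : b ∈ T) (hab : a ≤ b)
    (hf : ContinuousOn f (T ∩ Set.Icc a b)) {X : Set ℝ} (hX : X.Finite)
    (hd : ∀ s ∈ T, a < s → s ≤ b → (LeftDense T s → s ∉ X) →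
      HasNablaDeriv (T ∩ Set.Icc a b) f s (f' s))
    {M : ℝ} (hM : 0 ≤ M) (hf' : ∀ s ∈ T, a < s → s ≤ b → ‖f' s‖ ≤ M * ‖f s‖)
    (hfb : f b = 0) : f a = 0 := by
  refine backward_induction hT ha hb hab (P := fun s => f s = 0) hfb ?_ ?_ ?_
  · intro s hs has hsb r hr har hrs hgap hPs
    have hnd : ¬ LeftDense T s := fun h => by
      obtain ⟨t, ht⟩ := h.nonempty_Ioo r hrs
      exact (Set.eq_empty_iff_forall_notMem.1 hgap t) ht
    have h1 := (hd s hs has hsb fun h => absurd h hnd).eq_of_rho_ne ⟨hs, has.le, hsb⟩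
    have h2 : f' s = 0 := by
      have := hf' s hs has hsb
      rw [hPs, norm_zero, mul_zero] at this
      exact norm_le_zero_iff.1 this
    rwa [rho_inter_Icc ha has hsb, rho_of_gap hr hrs hgap, hPs, h2, smul_zero, sub_zero] at h1
  · intro s hs has hsb hld hPs
    -- The equation may fail at `s` itself, so Grönwall is applied on `[t, q]` with `q < s`, where
    -- finiteness of `X` rules out exceptions; then `q → s` by continuity.
    have hnear : ∀ᶠ t in 𝓝[<] s, t ∉ X := by
      have h1 : ∀ᶠ t in 𝓝 s, t ∉ X \ {s} :=
        (hX.subset Set.sdiff_subset).isClosed.isOpen_compl.mem_nhds (by simp)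
      filter_upwards [h1.filter_mono nhdsWithin_le_nhds, self_mem_nhdsWithin] with t ht hts htX
      exact ht ⟨htX, ne_of_lt hts⟩
    obtain ⟨r, hr, hrX⟩ := (mem_nhdsLT_iff_exists_Ioo_subset' has).1 hnear
    refine ⟨r, hr, fun t ht hrt hts hat => ?_⟩
    have hne := nhdsWithin_Iio_neBot hld hts
    have hcf : ContinuousWithinAt f (T ∩ Set.Ioo t s) s :=
      (hf s ⟨hs, has.le, hsb⟩).mono fun q hq =>
        ⟨hq.1, hat.trans hq.2.1.le, hq.2.2.le.trans hsb⟩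
    have hlim : Tendsto (fun q => ‖f q‖ * Real.exp (M * (q - t))) (𝓝[T ∩ Set.Ioo t s] s)
        (𝓝 (‖f s‖ * Real.exp (M * (s - t)))) := by
      refine hcf.norm.mul ?_
      exact Continuous.continuousWithinAt (by fun_prop)
    rw [hPs, norm_zero, zero_mul] at hlim
    refine norm_le_zero_iff.1 (ge_of_tendsto hlim ?_)
    filter_upwards [self_mem_nhdsWithin] with q hq
    have hqb : q ≤ b := hq.2.2.le.trans hsb
    have hsub : T ∩ Set.Icc t q ⊆ T ∩ Set.Icc a b :=
      fun x hx => ⟨hx.1, hat.trans hx.2.1, hx.2.2.trans hqb⟩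
    refine norm_le_mul_exp hT ht hq.1 hq.2.1.le (hf.mono hsub) (f' := f') ?_ hM ?_
    · intro x hx htx hxq
      refine (hd x hx (hat.trans_lt htx) (hxq.trans hqb) fun _ => ?_).mono hsub ?_
      · exact hrX ⟨hrt.trans htx, hxq.trans_lt hq.2.2⟩
      · rw [rho_inter_Icc ht htx hxq, rho_inter_Icc ha (hat.trans_lt htx) (hxq.trans hqb)]
    · exact fun x hx htx hxq => hf' x hx (hat.trans_lt htx) (hxq.trans hqb)
  · intro s hs has hsb hrd h
    have hne := nhdsWithin_Ioi_neBot hrd hsb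
    have hcf : ContinuousWithinAt f (T ∩ Set.Ioo s b) s :=
      (hf s ⟨hs, has, hsb.le⟩).mono fun t ht => ⟨ht.1, has.trans ht.2.1.le, ht.2.2.le⟩
    refine tendsto_nhds_unique hcf (tendsto_const_nhds.congr' ?_)
    filter_upwards [self_mem_nhdsWithin] with t ht using (h t ht.1 ht.2.1 ht.2.2.le).symm

/-- An invariant subspace is preserved by backward solutions. -/
theorem mem_of_nablaDeriv_sub_mem [FiniteDimensional ℝ E] (hT : IsClosed T) (ha : a ∈ T)
    (hb : b ∈ T) (hab : a ≤ b) (hf : ContinuousOn f (T ∩ Set.Icc a b)) {X : Set ℝ}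
    (hX : X.Finite) (hd : ∀ s ∈ T, a < s → s ≤ b → (LeftDense T s → s ∉ X) →
      HasNablaDeriv (T ∩ Set.Icc a b) f s (f' s))
    (V : Submodule ℝ E) (A : E →ₗ[ℝ] E) (hA : ∀ x ∈ V, A x ∈ V)
    (hf' : ∀ s ∈ T, f' s - A (f s) ∈ V) (hfb : f b ∈ V) : f a ∈ V := by
  have : IsClosed (V : Set E) := V.closed_of_finiteDimensional
  let π : E →L[ℝ] E ⧸ V := LinearMap.toContinuousLinearMap V.mkQ
  let Ā : (E ⧸ V) →L[ℝ] (E ⧸ V) := LinearMap.toContinuousLinearMap (V.mapQ V A hA)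
  have hπ : ∀ x, π x = 0 ↔ x ∈ V := fun x => Submodule.Quotient.mk_eq_zero V
  rw [← hπ] at hfb ⊢
  refine eq_zero_of_norm_nablaDeriv_le hT ha hb hab (f := fun s => π (f s))
    (f' := fun s => π (f' s)) (π.continuous.comp_continuousOn hf) hX
    (fun s hs has hsb h => (hd s hs has hsb h).clm_comp π) (norm_nonneg Ā) ?_ hfb
  intro s hs _ _
  have h1 : π (f' s) = Ā (π (f s)) := by
    have h2 : π (f' s - A (f s)) = 0 := (hπ _).2 (hf' s hs)
    rw [map_sub, sub_eq_zero] at h2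
    exact h2
  simp only [h1]
  exact Ā.le_opNorm _

end Comparison

end NablaControl

namespace NablaControl

open Matrix

/-! ### Matrix bounds, transition matrices and the cocycle property. -/

section Bounds

variable {k l : ℕ}

theorem norm_mulVec_le {M : Matrix (Fin k) (Fin l) ℝ} {K : ℝ} (hK : 0 ≤ K)
    (h : ∀ i j, |M i j| ≤ K) (x : Fin l → ℝ) : ‖M *ᵥ x‖ ≤ l * K * ‖x‖ := by
  rw [pi_norm_le_iff_of_nonneg (by positivity)]
  intro i
  rw [mulVec, dotProduct]
  refine (norm_sum_le _ _).trans ?_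
  have : ∀ j ∈ Finset.univ, ‖M i j * x j‖ ≤ K * ‖x‖ := fun j _ => by
    rw [norm_mul]
    exact mul_le_mul (h i j) (norm_le_pi_norm x j) (norm_nonneg _) hK
  refine (Finset.sum_le_card_nsmul _ _ _ this).trans (le_of_eq ?_)
  simp [mul_assoc]

theorem abs_entry_le_norm_mulVec_single (M : Matrix (Fin k) (Fin l) ℝ) (i : Fin k) (j : Fin l) :
    |M i j| ≤ ‖M *ᵥ Pi.single j 1‖ := by
  have := norm_le_pi_norm (M *ᵥ Pi.single j 1) i
  simpa using this

theorem exists_norm_mulVec_le (M : Matrix (Fin k) (Fin l) ℝ) :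
    ∃ K, 0 ≤ K ∧ ∀ x, ‖M *ᵥ x‖ ≤ K * ‖x‖ := by
  refine ⟨‖LinearMap.toContinuousLinearMap M.mulVecLin‖, norm_nonneg _, fun x => ?_⟩
  exact (LinearMap.toContinuousLinearMap M.mulVecLin).le_opNorm x

theorem continuous_mulVec_const (M : Matrix (Fin k) (Fin l) ℝ) :
    Continuous fun x : Fin l → ℝ => M *ᵥ x :=
  Continuous.matrix_mulVec continuous_const continuous_id

theorem HasNablaDeriv.const_mulVec {T : Set ℝ} {f : ℝ → Fin l → ℝ} {s : ℝ} {L : Fin l → ℝ}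
    (h : HasNablaDeriv T f s L) (M : Matrix (Fin k) (Fin l) ℝ) :
    HasNablaDeriv T (fun t => M *ᵥ f t) s (M *ᵥ L) :=
  h.clm_comp (LinearMap.toContinuousLinearMap M.mulVecLin)

end Bounds

section Transition

variable {n : ℕ} {T : Set ℝ} {A : ℝ → Matrix (Fin n) (Fin n) ℝ}
  {Ψ : ℝ → ℝ → Matrix (Fin n) (Fin n) ℝ}

theorem IsTransitionMatrix.continuousOn_mulVec (h : IsTransitionMatrix T A Ψ) {w : ℝ} (hw : w ∈ T)
    (x : Fin n → ℝ) (a : ℝ) {b : ℝ} (hb : b ≤ w) :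
    ContinuousOn (fun s => Ψ s w *ᵥ x) (T ∩ Set.Icc a b) := by
  have h1 : ContinuousOn (fun s => Ψ s w) (T ∩ Set.Icc a b) :=
    (h w hw).2.1.mono fun s hs => ⟨hs.1, hs.2.2.trans hb⟩
  have h2 : Continuous fun M : Matrix (Fin n) (Fin n) ℝ => M *ᵥ x :=
    Continuous.matrix_mulVec continuous_id continuous_const
  exact h2.comp_continuousOn h1

theorem IsTransitionMatrix.hasNablaDeriv_mulVec (h : IsTransitionMatrix T A Ψ) {w : ℝ}
    (hw : w ∈ T) (x : Fin n → ℝ) {a b s : ℝ} (ha : a ∈ T) (hb : b ≤ w) (hs : s ∈ T) (has : a < s)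
    (hsb : s ≤ b) :
    HasNablaDeriv (T ∩ Set.Icc a b) (fun s => Ψ s w *ᵥ x) s (A s *ᵥ (Ψ s w *ᵥ x)) := by
  rw [hasNablaDeriv_pi]
  intro i
  have h1 : ∀ j, HasNablaDeriv (T ∩ Set.Icc a b) (fun r => Ψ r w i j) s ((A s * Ψ s w) i j) := by
    intro j
    refine ((h w hw).2.2 s hs (hsb.trans hb) ⟨a, ha, has⟩ i j).mono
      (fun t ht => ⟨ht.1, ht.2.2.trans hb⟩) ?_
    rw [rho_inter_Icc ha has hsb, rho_inter_Iic (hsb.trans hb)]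
  rw [mulVec_mulVec]
  exact HasNablaDeriv.sum (I := Finset.univ) (f := fun j r => Ψ r w i j * x j) fun j _ =>
    (h1 j).clm_comp ((ContinuousLinearMap.mul ℝ ℝ).flip (x j))

/-- By compactness a local bound suffices. To the right of `s` it comes from the limit; to the left,
from continuity or from the absence of nearby points. -/
theorem exists_bound_of_ldContinuous {E : Type*} [NormedAddCommGroup E] {f : ℝ → E}
    (hT : IsClosed T) (hf : LdContinuous T f) (a b : ℝ) :
    ∃ K, 0 ≤ K ∧ ∀ s ∈ T, a ≤ s → s ≤ b → ‖f s‖ ≤ K := by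
  have hc : IsCompact (T ∩ Set.Icc a b) := isCompact_Icc.inter_left hT
  suffices ∃ K, ∀ s ∈ T ∩ Set.Icc a b, ‖f s‖ ≤ K by
    obtain ⟨K, hK⟩ := this
    exact ⟨max K 0, le_max_right _ _, fun s hs h1 h2 => (hK s ⟨hs, h1, h2⟩).trans (le_max_left _ _)⟩
  refine hc.induction_on (p := fun S => ∃ K, ∀ s ∈ S, ‖f s‖ ≤ K) ⟨0, by simp⟩
    (fun S S' hSS' ⟨K, hK⟩ => ⟨K, fun s hs => hK s (hSS' hs)⟩)
    (fun S S' ⟨K, hK⟩ ⟨K', hK'⟩ => ⟨max K K', ?_⟩) ?_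
  · rintro s (hs | hs)
    · exact (hK s hs).trans (le_max_left _ _)
    · exact (hK' s hs).trans (le_max_right _ _)
  intro s hs
  obtain ⟨hleft, l, hright⟩ := hf s hs.1
  have h1 : ∃ K, ∀ᶠ t in 𝓝[T ∩ Set.Iic s] s, ‖f t‖ ≤ K := by
    by_cases hld : LeftDense T s
    · refine ⟨‖f s‖ + 1, ?_⟩
      have := (((hleft hld).mono Set.inter_subset_left : ContinuousWithinAt f (T ∩ Set.Iic s) s).norm).tendsto
      filter_upwards [this.eventually_lt_const (lt_add_one _)] with t ht using ht.le
    · refine ⟨‖f s‖, ?_⟩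
      have : ∃ r < s, T ∩ Set.Ioo r s = ∅ := by
        by_contra! h
        exact hld (leftDense_of_forall_nonempty h)
      obtain ⟨r, hr, hgap⟩ := this
      have hr' : ∀ᶠ t in 𝓝[T ∩ Set.Iic s] s, r < t :=
        (lt_mem_nhds hr).filter_mono nhdsWithin_le_nhds
      filter_upwards [self_mem_nhdsWithin, hr'] with t ht hrt
      rcases (Set.mem_Iic.1 ht.2).eq_or_lt with h | h
      · rw [h]
      · exact absurd ⟨ht.1, hrt, h⟩ (Set.eq_empty_iff_forall_notMem.1 hgap t)
  obtain ⟨K₁, hK₁⟩ := h1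
  have hK₂ : ∀ᶠ t in 𝓝[T ∩ Set.Ioi s] s, ‖f t‖ ≤ ‖l‖ + 1 := by
    filter_upwards [hright.norm.eventually_lt_const (lt_add_one _)] with t ht using ht.le
  have hmem : ∀ᶠ t in 𝓝[T ∩ Set.Icc a b] s, ‖f t‖ ≤ max K₁ (‖l‖ + 1) := by
    rw [eventually_nhdsWithin_iff] at hK₁ hK₂ ⊢
    filter_upwards [hK₁, hK₂] with t ht1 ht2 ht
    rcases le_or_gt t s with h | h
    · exact (ht1 ⟨ht.1, h⟩).trans (le_max_left _ _)
    · exact (ht2 ⟨ht.1, h⟩).trans (le_max_right _ _)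
  exact ⟨_, hmem, _, fun t ht => ht⟩

theorem LdContinuous.exists_entry_bound {k l : ℕ} {M : ℝ → Matrix (Fin k) (Fin l) ℝ}
    (hT : IsClosed T) (h : LdContinuous T M) (a b : ℝ) :
    ∃ K, 0 ≤ K ∧ ∀ s ∈ T, a ≤ s → s ≤ b → ∀ i j, |M s i j| ≤ K := by
  have h' : LdContinuous T (E := Fin k → Fin l → ℝ) M := h
  obtain ⟨K, hK, hb⟩ := exists_bound_of_ldContinuous (E := Fin k → Fin l → ℝ) hT h' a b
  exact ⟨K, hK, fun s hs h1 h2 i j => ((norm_le_pi_norm (M s i) j).trans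
    (norm_le_pi_norm (f := fun i => M s i) i)).trans (hb s hs h1 h2)⟩

theorem IsTransitionMatrix.mul (hT : IsClosed T) (hA : LdContinuous T A)
    (h : IsTransitionMatrix T A Ψ) {r s w : ℝ} (hr : r ∈ T) (hs : s ∈ T) (hw : w ∈ T)
    (hrs : r ≤ s) (hsw : s ≤ w) : Ψ r s * Ψ s w = Ψ r w := by
  obtain ⟨K, hK, hb⟩ := hA.exists_entry_bound hT r s
  refine Matrix.mulVec_injective (funext fun x => ?_)
  rw [← mulVec_mulVec, ← sub_eq_zero]
  refine eq_zero_of_norm_nablaDeriv_le hT hr hs hrs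
    (f := fun t => Ψ t s *ᵥ (Ψ s w *ᵥ x) - Ψ t w *ᵥ x)
    (f' := fun t => A t *ᵥ (Ψ t s *ᵥ (Ψ s w *ᵥ x) - Ψ t w *ᵥ x))
    ((h.continuousOn_mulVec hs _ _ le_rfl).sub (h.continuousOn_mulVec hw _ _ hsw))
    Set.finite_empty ?_ (M := n * K) (by positivity) ?_ ?_
  · intro t ht hrt hts _
    refine ((h.hasNablaDeriv_mulVec hs _ hr le_rfl ht hrt hts).sub
      (h.hasNablaDeriv_mulVec hw _ hr hsw ht hrt hts)).congr_deriv ?_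
    rw [mulVec_sub]
  · exact fun t ht hrt hts => norm_mulVec_le hK (hb t ht hrt.le hts) _
  · simp [(h s hs).1]

end Transition

/-- `Φ` behaves like the transition matrix of a constant matrix `A` on `T`: it is a cocycle, it is
`1 - ν A` across gaps, and it is `1 - (w - s) A` up to second order. -/
structure IsCocycle {n : ℕ} (T : Set ℝ) (A : Matrix (Fin n) (Fin n) ℝ)
    (Φ : ℝ → ℝ → Matrix (Fin n) (Fin n) ℝ) : Prop where
  one : ∀ s ∈ T, Φ s s = 1
  mul : ∀ r ∈ T, ∀ s ∈ T, ∀ w ∈ T, r ≤ s → s ≤ w → Φ r s * Φ s w = Φ r w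
  gap : ∀ r ∈ T, ∀ s ∈ T, r < s → T ∩ Set.Ioo r s = ∅ → Φ r s = 1 - (s - r) • A
  est : ∀ a b : ℝ, ∃ K, 0 ≤ K ∧ ∀ s ∈ T, ∀ w ∈ T, a ≤ s → s ≤ w → w ≤ b → ∀ i j,
    |(Φ s w - 1 + (w - s) • A) i j| ≤ K * (w - s) ^ 2

theorem IsTransitionMatrix.isCocycle {n : ℕ} {T : Set ℝ} (hT : IsClosed T)
    {A : Matrix (Fin n) (Fin n) ℝ} {Ψ : ℝ → ℝ → Matrix (Fin n) (Fin n) ℝ}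
    (h : IsTransitionMatrix T (fun _ => A) Ψ) : IsCocycle T A Ψ where
  one s hs := (h s hs).1
  mul r hr s hs w hw hrs hsw := by
    refine h.mul hT ?_ hr hs hw hrs hsw
    exact fun s _ => ⟨fun _ => continuousWithinAt_const, A, tendsto_const_nhds⟩
  gap r hr s hs hrs hgap := by
    refine Matrix.mulVec_injective (funext fun x => ?_)
    have h1 := (h.hasNablaDeriv_mulVec hs x hr le_rfl hs hrs le_rfl).eq_of_rho_ne
      ⟨hs, hrs.le, le_rfl⟩
    rw [rho_inter_Icc hr hrs le_rfl, rho_of_gap hr hrs hgap, (h s hs).1, one_mulVec] at h1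
    rw [h1, sub_mulVec, one_mulVec, smul_mulVec]
  est a b := by
    obtain ⟨M, hM, hA⟩ := exists_norm_mulVec_le A
    refine ⟨M * (M * (Real.exp (M * (b - a)))), by positivity, ?_⟩
    intro s hs w hw has hsw hwb i j
    set x : Fin n → ℝ := Pi.single j 1 with hx
    have hx1 : ‖x‖ ≤ 1 := by
      rw [pi_norm_le_iff_of_nonneg zero_le_one]
      intro i
      by_cases hij : i = j
      · subst hij; simp [hx]
      · simp [hx, hij]
    set E := Real.exp (M * (b - a)) with hE
    -- The solution is bounded, so its derivative is; hence it is close to `x` to first order, and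
    -- feeding this back into the mean value inequality gives second order.
    have growth : ∀ t ∈ T, s ≤ t → t ≤ w → ‖Ψ t w *ᵥ x‖ ≤ E := by
      intro t ht hst htw
      have := norm_le_mul_exp hT ht hw htw (h.continuousOn_mulVec hw x t le_rfl)
        (f' := fun r => A *ᵥ (Ψ r w *ᵥ x))
        (fun r hr htr hrw => h.hasNablaDeriv_mulVec hw x ht le_rfl hr htr hrw) hM
        (fun r hr htr hrw => hA _)
      refine this.trans ?_
      rw [(h w hw).1, one_mulVec]
      have h2 : Real.exp (M * (w - t)) ≤ E := by
        rw [hE]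
        gcongr
        linarith
      calc ‖x‖ * Real.exp (M * (w - t)) ≤ 1 * E :=
            mul_le_mul hx1 h2 (Real.exp_pos _).le zero_le_one
        _ = E := one_mul _
    have first : ∀ t ∈ T, s ≤ t → t ≤ w → ‖Ψ t w *ᵥ x - x‖ ≤ M * E * (w - t) := by
      intro t ht hst htw
      have := norm_sub_le_of_nablaDeriv_le hT ht hw htw (h.continuousOn_mulVec hw x t le_rfl)
        (f' := fun r => A *ᵥ (Ψ r w *ᵥ x)) (K := M * E)
        (fun r hr htr hrw => h.hasNablaDeriv_mulVec hw x ht le_rfl hr htr hrw)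
        (fun r hr htr hrw => (hA _).trans
          (mul_le_mul_of_nonneg_left (growth r hr (hst.trans htr.le) hrw) hM))
      rwa [(h w hw).1, one_mulVec] at this
    have second := norm_sub_le_of_nablaDeriv_le hT hs hw hsw
      (f := fun t => Ψ t w *ᵥ x - t • (A *ᵥ x)) (f' := fun t => A *ᵥ (Ψ t w *ᵥ x) - A *ᵥ x)
      (K := M * (M * E * (w - s)))
      ((h.continuousOn_mulVec hw x s le_rfl).sub (Continuous.continuousOn (by fun_prop)))
      (fun t ht hst htw => (h.hasNablaDeriv_mulVec hw x hs le_rfl ht hst htw).sub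
        (hasNablaDeriv_smul_const _))
      (fun t ht hst htw => by
        rw [← mulVec_sub]
        refine (hA _).trans (mul_le_mul_of_nonneg_left ((first t ht hst.le htw).trans ?_) hM)
        exact mul_le_mul_of_nonneg_left (by linarith) (by positivity))
    refine (abs_entry_le_norm_mulVec_single _ i j).trans ?_
    rw [(h w hw).1, one_mulVec] at second
    have e : (Ψ s w - 1 + (w - s) • A) *ᵥ Pi.single j 1 =
        Ψ s w *ᵥ x - s • (A *ᵥ x) - (x - w • (A *ᵥ x)) := by
      rw [← hx, add_mulVec, sub_mulVec, one_mulVec, smul_mulVec, sub_smul]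
      abel
    rw [e]
    refine second.trans (le_of_eq ?_)
    ring

section Cocycle

variable {n : ℕ} {T : Set ℝ} {A : Matrix (Fin n) (Fin n) ℝ}
  {Φ : ℝ → ℝ → Matrix (Fin n) (Fin n) ℝ}

/-- The cocycle axioms are symmetric in the two time arguments, unlike the differential equation,
which concerns only the first. This duality turns observability statements into controllability
statements. -/
theorem IsCocycle.reflect (h : IsCocycle T A Φ) :
    IsCocycle (-T) Aᵀ fun u v => (Φ (-v) (-u))ᵀ where
  one s hs := by rw [h.one _ hs, transpose_one]
  mul r hr s hs w hw hrs hsw := by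
    rw [← transpose_mul, h.mul _ hw _ hs _ hr (by linarith) (by linarith)]
  gap r hr s hs hrs hgap := by
    rw [h.gap _ hs _ hr (by linarith) ?_]
    · rw [transpose_sub, transpose_one, transpose_smul]
      congr 2
      ring
    · rw [Set.eq_empty_iff_forall_notMem] at hgap ⊢
      rintro t ⟨ht, h1, h2⟩
      refine hgap (-t) ⟨by simpa using ht, by linarith, by linarith⟩
  est a b := by
    obtain ⟨K, hK, hest⟩ := h.est (-b) (-a)
    refine ⟨K, hK, fun s hs w hw has hsw hwb i j => ?_⟩
    have := hest _ hw _ hs (by linarith) (by linarith) (by linarith) j i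
    have e1 : -s - -w = w - s := by ring
    rw [e1] at this
    simpa [Matrix.one_apply, eq_comm] using this

theorem IsCocycle.norm_sub_add_le (h : IsCocycle T A Φ) (a b : ℝ) :
    ∃ K, 0 ≤ K ∧ ∀ s ∈ T, ∀ w ∈ T, a ≤ s → s ≤ w → w ≤ b → ∀ x,
      ‖Φ s w *ᵥ x - x + (w - s) • (A *ᵥ x)‖ ≤ K * (w - s) ^ 2 * ‖x‖ := by
  obtain ⟨K, hK, hest⟩ := h.est a b
  refine ⟨n * K, by positivity, fun s hs w hw has hsw hwb x => ?_⟩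
  have := norm_mulVec_le (by positivity) (hest s hs w hw has hsw hwb) x
  rw [add_mulVec, sub_mulVec, one_mulVec, smul_mulVec] at this
  refine this.trans (le_of_eq (by ring))

theorem IsCocycle.norm_sub_le (h : IsCocycle T A Φ) (a b : ℝ) :
    ∃ K, 0 ≤ K ∧ ∀ s ∈ T, ∀ w ∈ T, a ≤ s → s ≤ w → w ≤ b → ∀ x,
      ‖Φ s w *ᵥ x - x‖ ≤ K * (w - s) * ‖x‖ := by
  obtain ⟨K, hK, hest⟩ := h.norm_sub_add_le a b
  obtain ⟨M, hM, hA⟩ := exists_norm_mulVec_le A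
  by_cases hab : a ≤ b
  swap
  · exact ⟨0, le_rfl, fun s hs w hw h1 h2 h3 => absurd (h1.trans (h2.trans h3)) hab⟩
  refine ⟨K * (b - a) + M, by have := sub_nonneg.2 hab; positivity,
    fun s hs w hw has hsw hwb x => ?_⟩
  have e : Φ s w *ᵥ x - x =
      (Φ s w *ᵥ x - x + (w - s) • (A *ᵥ x)) - (w - s) • (A *ᵥ x) := by abel
  rw [e]
  refine (_root_.norm_sub_le _ _).trans ?_
  rw [norm_smul, Real.norm_of_nonneg (by linarith)]
  have h1 := hest s hs w hw has hsw hwb x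
  have h2 := mul_le_mul_of_nonneg_left (hA x) (by linarith : 0 ≤ w - s)
  have h3 : K * (w - s) ^ 2 * ‖x‖ ≤ K * (b - a) * (w - s) * ‖x‖ := by
    refine mul_le_mul_of_nonneg_right ?_ (norm_nonneg _)
    rw [pow_two, ← mul_assoc]
    refine mul_le_mul_of_nonneg_right ?_ (by linarith)
    exact mul_le_mul_of_nonneg_left (by linarith) hK
  nlinarith

end Cocycle

end NablaControl

namespace NablaControl

open Matrix

/-! ### Algebraic observability and controllability, and their detection on `T`. -/

section Pairs

variable {n m p : ℕ}

/-- The pair `(A, C)` has no nonzero unobservable state. -/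
def ObservablePair (A : Matrix (Fin n) (Fin n) ℝ) (C : Matrix (Fin p) (Fin n) ℝ) : Prop :=
  ∀ x : Fin n → ℝ, (∀ k : ℕ, (C * A ^ k) *ᵥ x = 0) → x = 0

/-- The pair `(A, B)` is controllable: no nonzero covector annihilates all `A ^ k * B`. -/
def ControllablePair (A : Matrix (Fin n) (Fin n) ℝ) (B : Matrix (Fin n) (Fin m) ℝ) : Prop :=
  ObservablePair Aᵀ Bᵀ

/-- Cayley-Hamilton: every power of `A` is a combination of the first `n` powers. -/
theorem mul_pow_mulVec_eq_zero {A : Matrix (Fin n) (Fin n) ℝ} {C : Matrix (Fin p) (Fin n) ℝ}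
    {x : Fin n → ℝ} (h : ∀ k < n, (C * A ^ k) *ᵥ x = 0) (k : ℕ) : (C * A ^ k) *ᵥ x = 0 := by
  rcases Nat.eq_zero_or_pos n with rfl | hn
  · rw [Subsingleton.elim x 0, mulVec_zero]
  have hdeg : (Polynomial.X ^ k %ₘ A.charpoly).natDegree < n := by
    have h1 := Polynomial.natDegree_modByMonic_lt (Polynomial.X ^ k : Polynomial ℝ)
      A.charpoly_monic (fun h => by
        have := A.charpoly_natDegree_eq_dim
        rw [h, Polynomial.natDegree_one, Fintype.card_fin] at this
        omega)
    rwa [A.charpoly_natDegree_eq_dim, Fintype.card_fin] at h1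
  rw [A.pow_eq_aeval_mod_charpoly k, Polynomial.aeval_eq_sum_range' hdeg, Matrix.mul_sum,
    sum_mulVec]
  refine Finset.sum_eq_zero fun i hi => ?_
  rw [Matrix.mul_smul, smul_mulVec, h i (Finset.mem_range.1 hi), smul_zero]

end Pairs

section Cocycle

variable {n p m : ℕ} {T : Set ℝ} {A : Matrix (Fin n) (Fin n) ℝ}
  {Φ : ℝ → ℝ → Matrix (Fin n) (Fin n) ℝ}

theorem eq_zero_of_norm_le_mul {E : Type*} [NormedAddCommGroup E] {x : E} {K : ℝ}
    (h : ∀ ε > 0, ∃ δ, δ ≤ ε ∧ 0 ≤ δ ∧ ‖x‖ ≤ K * δ) : x = 0 := by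
  rw [← norm_le_zero_iff]
  refine le_of_forall_pos_le_add fun ε hε => ?_
  obtain ⟨δ, hδ, hδ0, hx⟩ := h (ε / (|K| + 1)) (by positivity)
  rw [zero_add]
  refine hx.trans ?_
  calc K * δ ≤ (|K| + 1) * δ := mul_le_mul_of_nonneg_right (by linarith [le_abs_self K]) hδ0
    _ ≤ (|K| + 1) * (ε / (|K| + 1)) := mul_le_mul_of_nonneg_left hδ (by positivity)
    _ = ε := by field_simp

/-- An output that vanishes at points approximating every point of `T ∩ (a, w]` from the left has
vanishing `k`-th derivative at every point with at least `k` points between it and `a`. -/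
theorem IsCocycle.mul_pow_mulVec_eq_zero (hT : IsClosed T) (h : IsCocycle T A Φ) {a w : ℝ}
    (hw : w ∈ T) {C : Matrix (Fin p) (Fin n) ℝ} {x : Fin n → ℝ}
    (hC : ∀ r ∈ T, a < r → r ≤ w → ∀ ε > 0, ∃ r' ∈ T, r - ε < r' ∧ r' ≤ r ∧
      C *ᵥ (Φ r' w *ᵥ x) = 0) (k : ℕ) :
    ∀ s ∈ T, a < s → s ≤ w → (k : ℕ∞) ≤ (T ∩ Set.Ioo a s).encard →
      (C * A ^ k) *ᵥ (Φ s w *ᵥ x) = 0 := by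
  induction k with
  | zero =>
    intro s hs has hsw _
    rw [pow_zero, Matrix.mul_one]
    set y := Φ s w *ᵥ x with hy
    obtain ⟨K, hK, hest⟩ := h.norm_sub_le (s - 1) s
    obtain ⟨c, hc, hCc⟩ := exists_norm_mulVec_le C
    refine eq_zero_of_norm_le_mul (K := c * K * ‖y‖) fun ε hε => ?_
    obtain ⟨r, hr, hεr, hrs, h0⟩ := hC s hs has hsw (min ε 1) (lt_min hε one_pos)
    refine ⟨s - r, ?_, by linarith, ?_⟩
    · linarith [min_le_left ε 1]
    rw [← h.mul r hr s hs w hw hrs hsw, ← mulVec_mulVec, ← hy] at h0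
    have e : C *ᵥ y = - (C *ᵥ (Φ r s *ᵥ y - y)) := by rw [mulVec_sub, h0]; simp
    rw [e, norm_neg]
    refine (hCc _).trans ((mul_le_mul_of_nonneg_left
      (hest r hr s hs (by linarith [min_le_right ε 1]) hrs le_rfl y) hc).trans (le_of_eq ?_))
    ring
  | succ k ih =>
    intro s hs has hsw hk
    set y := Φ s w *ᵥ x with hy
    have hk' : (k : ℕ∞) ≤ (T ∩ Set.Ioo a s).encard :=
      le_trans (by exact_mod_cast Nat.le_succ k) hk
    have hky : (C * A ^ k) *ᵥ y = 0 := ih s hs has hsw hk'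
    obtain ⟨a₀, ha₀, ha₀'⟩ : (T ∩ Set.Ioo a s).Nonempty := by
      rw [← Set.encard_ne_zero]
      rintro h0
      rw [h0] at hk
      simp at hk
    have step : ∀ t ∈ T, a < t → t < s → (k : ℕ∞) ≤ (T ∩ Set.Ioo a t).encard →
        (C * A ^ k) *ᵥ (Φ t s *ᵥ y) = 0 := by
      intro t ht hat hts hkt
      rw [hy, mulVec_mulVec x (Φ t s), h.mul t ht s hs w hw hts.le hsw]
      exact ih t ht hat (hts.le.trans hsw) hkt
    -- Across a gap, `C A ^ k` kills both `y` and `(1 - (s - r) A) y`, hence `A y`; the predecessor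
    -- `r` is the one point used up.
    rcases exists_gap_or_leftDense hT ha₀ ha₀'.2 with ⟨r, hr, har, hrs, hgap⟩ | hld
    · have hsub : T ∩ Set.Ioo a s ⊆ insert r (T ∩ Set.Ioo a r) := by
        rintro t ⟨ht, hat, hts⟩
        rcases lt_trichotomy t r with h1 | h1 | h1
        · exact Or.inr ⟨ht, hat, h1⟩
        · exact Or.inl h1
        · exact absurd ⟨ht, h1, hts⟩ (Set.eq_empty_iff_forall_notMem.1 hgap t)
      have hkr : (k : ℕ∞) ≤ (T ∩ Set.Ioo a r).encard := by
        have := (hk.trans (Set.encard_le_encard hsub)).trans (Set.encard_insert_le _ _)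
        rw [Nat.cast_succ] at this
        exact (ENat.add_le_add_iff_right ENat.one_ne_top).1 this
      have h1 := step r hr (ha₀'.1.trans_le har) hrs hkr
      rw [h.gap r hr s hs hrs hgap, sub_mulVec, one_mulVec, mulVec_sub, hky, zero_sub,
        smul_mulVec, mulVec_smul, neg_eq_zero] at h1
      rw [pow_succ, ← Matrix.mul_assoc, ← mulVec_mulVec]
      exact (smul_eq_zero.1 h1).resolve_left (by linarith)
    -- Fixing `k` points below `s` keeps the induction hypothesis available at every `t` near `s`;
    -- the difference quotient then has error of order `s - t`.
    · obtain ⟨F, hF, hFk⟩ := Set.exists_subset_encard_eq hk'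
      have hFfin : F.Finite := Set.finite_of_encard_eq_coe hFk
      have hev : ∀ᶠ t in 𝓝[<] s, ∀ q ∈ F, q < t :=
        (eventually_all_finite hFfin).2 fun q hq =>
          (lt_mem_nhds (hF hq).2.2).filter_mono nhdsWithin_le_nhds
      obtain ⟨c, hcs, hc⟩ := (mem_nhdsLT_iff_exists_Ioo_subset' ha₀'.2).1 hev
      obtain ⟨K, hK, hest⟩ := h.norm_sub_add_le (s - 1) s
      obtain ⟨M, hM, hCM⟩ := exists_norm_mulVec_le (C * A ^ k)
      refine eq_zero_of_norm_le_mul (K := M * K * ‖y‖) fun ε hε => ?_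
      obtain ⟨t, ht, hlt, hts⟩ := hld (max (max a c) (max (s - 1) (s - ε)))
        (max_lt (max_lt has hcs) (max_lt (by linarith) (by linarith)))
      simp only [max_lt_iff] at hlt
      obtain ⟨⟨hat, hct⟩, h1t, hεt⟩ := hlt
      refine ⟨s - t, by linarith, by linarith, ?_⟩
      have hkt : (k : ℕ∞) ≤ (T ∩ Set.Ioo a t).encard := by
        rw [← hFk]
        refine Set.encard_le_encard fun q hq => ⟨(hF hq).1, (hF hq).2.1, hc ⟨hct, hts⟩ q hq⟩
      have h1 := step t ht hat hts hkt
      have e : (s - t) • ((C * A ^ (k + 1)) *ᵥ y) =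
          (C * A ^ k) *ᵥ (Φ t s *ᵥ y - y + (s - t) • (A *ᵥ y)) := by
        rw [mulVec_add, mulVec_sub, h1, hky, sub_zero, zero_add, mulVec_smul, pow_succ,
          ← Matrix.mul_assoc, ← mulVec_mulVec y (C * A ^ k)]
      have h2 : (s - t) * ‖(C * A ^ (k + 1)) *ᵥ y‖ ≤ (s - t) * (M * K * ‖y‖ * (s - t)) := by
        rw [← Real.norm_of_nonneg (by linarith : 0 ≤ s - t), ← norm_smul, e,
          Real.norm_of_nonneg (by linarith : 0 ≤ s - t)]
        refine (hCM _).trans ((mul_le_mul_of_nonneg_left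
          (hest t ht s hs h1t.le hts.le le_rfl y) hM).trans (le_of_eq ?_))
        ring
      exact le_of_mul_le_mul_left h2 (by linarith)

/-- Since `w` is one of the `n` points, `n - 1` lie strictly between `a` and `w`, just enough for
the powers `k < n`. -/
theorem IsCocycle.eq_zero_of_observablePair (hT : IsClosed T) (h : IsCocycle T A Φ) {a w : ℝ}
    (hw : w ∈ T) {C : Matrix (Fin p) (Fin n) ℝ} (hAC : ObservablePair A C)
    (hcard : (n : ℕ∞) ≤ (T ∩ Set.Ioc a w).encard) {x : Fin n → ℝ}
    (hC : ∀ r ∈ T, a < r → r ≤ w → ∀ ε > 0, ∃ r' ∈ T, r - ε < r' ∧ r' ≤ r ∧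
      C *ᵥ (Φ r' w *ᵥ x) = 0) : x = 0 := by
  refine hAC x (NablaControl.mul_pow_mulVec_eq_zero fun k hk => ?_)
  have haw : a < w := by
    by_contra! haw
    rw [Set.Ioc_eq_empty (not_lt.2 haw), Set.inter_empty, Set.encard_empty] at hcard
    have : n ≤ 0 := by exact_mod_cast hcard
    omega
  have h1 := h.mul_pow_mulVec_eq_zero hT hw hC k w hw haw le_rfl ?_
  · rwa [h.one w hw, one_mulVec] at h1
  · have hsub : T ∩ Set.Ioc a w ⊆ insert w (T ∩ Set.Ioo a w) := by
      rintro t ⟨ht, hat, htw⟩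
      rcases htw.eq_or_lt with h1 | h1
      · exact Or.inl h1
      · exact Or.inr ⟨ht, hat, h1⟩
    have h2 := (hcard.trans (Set.encard_le_encard hsub)).trans (Set.encard_insert_le _ _)
    have h3 : ((k + 1 : ℕ) : ℕ∞) ≤ (T ∩ Set.Ioo a w).encard + 1 :=
      le_trans (by exact_mod_cast hk) h2
    rw [Nat.cast_succ] at h3
    exact (ENat.add_le_add_iff_right ENat.one_ne_top).1 h3

theorem IsCocycle.eq_zero_of_controllablePair (hT : IsClosed T) (h : IsCocycle T A Φ) {s b : ℝ}
    (hs : s ∈ T) {B : Matrix (Fin n) (Fin m) ℝ} (hAB : ControllablePair A B)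
    (hcard : (n : ℕ∞) ≤ (T ∩ Set.Ico s b).encard) {x : Fin n → ℝ}
    (hB : ∀ r ∈ T, s ≤ r → r < b → ∀ ε > 0, ∃ r' ∈ T, r ≤ r' ∧ r' < r + ε ∧
      x ᵥ* (Φ s r' * B) = 0) : x = 0 := by
  refine h.reflect.eq_zero_of_observablePair (a := -b) (w := -s) hT.neg (by simpa using hs) hAB
    ?_ ?_
  · have : -T ∩ Set.Ioc (-b) (-s) = (fun t => -t) '' (T ∩ Set.Ico s b) := by
      ext t
      simp only [Set.mem_inter_iff, Set.mem_neg, Set.mem_Ioc, Set.mem_image, Set.mem_Ico]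
      constructor
      · rintro ⟨h1, h2, h3⟩
        exact ⟨-t, ⟨h1, by linarith, by linarith⟩, neg_neg t⟩
      · rintro ⟨q, ⟨h1, h2, h3⟩, rfl⟩
        exact ⟨by simpa using h1, by linarith, by linarith⟩
    rw [this, neg_injective.encard_image]
    exact hcard
  · intro r hr hbr hrs ε hε
    obtain ⟨r', hr', h1, h2, h3⟩ := hB (-r) hr (by linarith) (by linarith) ε hε
    refine ⟨-r', by simpa using hr', by linarith, by linarith, ?_⟩
    rw [neg_neg, neg_neg, mulVec_mulVec, ← transpose_mul, mulVec_transpose, h3]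

end Cocycle

end NablaControl

namespace NablaControl

open Matrix

/-! ### Controllability and observability on an interval versus the pairs. -/

section Invariance

variable {n m p : ℕ} {T : Set ℝ} {A : Matrix (Fin n) (Fin n) ℝ} {B : Matrix (Fin n) (Fin m) ℝ}
  {C : Matrix (Fin p) (Fin n) ℝ} {Ψ : ℝ → ℝ → Matrix (Fin n) (Fin n) ℝ} {s₁ s₀ : ℝ}

theorem IsTransitionMatrix.mulVec_mem (hT : IsClosed T)
    (h : IsTransitionMatrix T (fun _ => A) Ψ) (V : Submodule ℝ (Fin n → ℝ))
    (hV : ∀ x ∈ V, A *ᵥ x ∈ V) {s w : ℝ} (hs : s ∈ T) (hw : w ∈ T) (hsw : s ≤ w)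
    {x : Fin n → ℝ} (hx : x ∈ V) : Ψ s w *ᵥ x ∈ V := by
  refine mem_of_nablaDeriv_sub_mem hT hs hw hsw (f := fun t => Ψ t w *ᵥ x)
    (f' := fun t => A *ᵥ (Ψ t w *ᵥ x)) (h.continuousOn_mulVec hw x s le_rfl) Set.finite_empty
    (fun t ht hst htw _ => h.hasNablaDeriv_mulVec hw x hs le_rfl ht hst htw)
    V A.mulVecLin hV (fun t _ => ?_) ?_
  · rw [mulVecLin_apply, sub_self]
    exact V.zero_mem
  · rwa [(h w hw).1, one_mulVec]

theorem PiecewiseLdContinuous.exists_finite {v : ℝ → Fin m → ℝ} (hs₁ : s₁ ∈ T)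
    (hv : PiecewiseLdContinuous (T ∩ Set.Icc s₁ s₀) v) :
    ∃ X : Set ℝ, X.Finite ∧ ∀ s ∈ T, s₁ < s → s ≤ s₀ → (LeftDense T s → s ∉ X) →
      LeftDense T s → ContinuousWithinAt v (T ∩ Set.Icc s₁ s₀) s := by
  refine ⟨_, hv.2, fun s hs h1 h2 h3 h4 => ?_⟩
  by_contra hc
  exact h3 h4 ⟨⟨hs, h1.le, h2⟩, (leftDense_inter_Icc_iff hs₁ h1 h2).2 h4, hc⟩

/-- The states that are not seen by the output. -/
def unobservableSubspace (A : Matrix (Fin n) (Fin n) ℝ) (C : Matrix (Fin p) (Fin n) ℝ) :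
    Submodule ℝ (Fin n → ℝ) :=
  ⨅ k : ℕ, LinearMap.ker (C * A ^ k).mulVecLin

theorem mem_unobservableSubspace {x : Fin n → ℝ} :
    x ∈ unobservableSubspace A C ↔ ∀ k : ℕ, (C * A ^ k) *ᵥ x = 0 := by
  simp [unobservableSubspace, Submodule.mem_iInf]

theorem mulVec_mem_unobservableSubspace {x : Fin n → ℝ} (hx : x ∈ unobservableSubspace A C) :
    A *ᵥ x ∈ unobservableSubspace A C := by
  rw [mem_unobservableSubspace] at hx ⊢
  intro k
  rw [mulVec_mulVec, Matrix.mul_assoc, ← pow_succ]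
  exact hx (k + 1)

theorem observablePair_iff : ObservablePair A C ↔ unobservableSubspace A C = ⊥ := by
  rw [Submodule.eq_bot_iff]
  simp only [mem_unobservableSubspace, ObservablePair]

/-- The annihilator of the covectors that are not reached by the input. -/
def reachableSubspace (A : Matrix (Fin n) (Fin n) ℝ) (B : Matrix (Fin n) (Fin m) ℝ) :
    Submodule ℝ (Fin n → ℝ) :=
  ⨅ x : unobservableSubspace Aᵀ Bᵀ, LinearMap.ker (dotProductBilin ℝ ℝ (x : Fin n → ℝ))

theorem mem_reachableSubspace {y : Fin n → ℝ} :
    y ∈ reachableSubspace A B ↔ ∀ x ∈ unobservableSubspace Aᵀ Bᵀ, x ⬝ᵥ y = 0 := by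
  simp [reachableSubspace, Submodule.mem_iInf]

theorem mulVec_mem_reachableSubspace {y : Fin n → ℝ} (hy : y ∈ reachableSubspace A B) :
    A *ᵥ y ∈ reachableSubspace A B := by
  rw [mem_reachableSubspace] at hy ⊢
  intro x hx
  rw [dotProduct_mulVec, ← mulVec_transpose]
  exact hy _ (mulVec_mem_unobservableSubspace hx)

theorem input_mem_reachableSubspace (u : Fin m → ℝ) : B *ᵥ u ∈ reachableSubspace A B := by
  rw [mem_reachableSubspace]
  intro x hx
  have := mem_unobservableSubspace.1 hx 0
  rw [pow_zero, Matrix.mul_one] at this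
  rw [dotProduct_mulVec, ← mulVec_transpose, this, zero_dotProduct]

theorem controllablePair_iff : ControllablePair A B ↔ reachableSubspace A B = ⊤ := by
  rw [ControllablePair, observablePair_iff, Submodule.eq_bot_iff, Submodule.eq_top_iff']
  constructor
  · intro h y
    rw [mem_reachableSubspace]
    intro x hx
    rw [h x hx, zero_dotProduct]
  · intro h x hx
    exact dotProduct_self_eq_zero.1 (mem_reachableSubspace.1 (h x) x hx)

/-- An unobservable state evolves inside the unobservable subspace, so with zero control its output
cannot be told from that of the zero state. -/
theorem observablePair_of_observableOn (h : IsTransitionMatrix T (fun _ => A) Ψ)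
    (hT : IsClosed T) (hs₀ : s₀ ∈ T) (hs₁ : s₁ ∈ T)
    (hobs : ObservableOn T (LinSystem.const A B C) s₁ s₀) : ObservablePair A C := by
  intro x hx
  have hx' := mem_unobservableSubspace.2 hx
  have key := hobs (fun _ => 0) (fun s => Ψ s s₀ *ᵥ x) (fun _ => 0) ?_ ?_ ?_ ?_
  · simpa [(h s₀ hs₀).1] using key
  · refine ⟨fun s _ => ⟨⟨0, tendsto_const_nhds⟩, ⟨0, tendsto_const_nhds⟩⟩, ?_⟩
    simp [continuousWithinAt_const]
  · refine ⟨h.continuousOn_mulVec hs₀ x s₁ le_rfl, fun s hs h1 h2 _ => ?_⟩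
    rw [mulVec_zero, add_zero]
    exact h.hasNablaDeriv_mulVec hs₀ x hs₁ le_rfl hs h1 h2
  · refine ⟨continuousOn_const, fun s hs h1 h2 _ => ?_⟩
    rw [mulVec_zero, mulVec_zero, add_zero]
    exact hasNablaDeriv_const 0
  · intro s hs h1 h2
    have := h.mulVec_mem hT (unobservableSubspace A C)
      (fun x hx => mulVec_mem_unobservableSubspace hx) hs hs₀ h2 hx'
    have := mem_unobservableSubspace.1 this 0
    rw [pow_zero, Matrix.mul_one] at this
    simpa [LinSystem.const] using this

/-- Trajectories that start at `0` never leave the reachable subspace. -/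
theorem controllablePair_of_controllableOn (hT : IsClosed T) (hs₀ : s₀ ∈ T) (hs₁ : s₁ ∈ T)
    (hs : s₁ < s₀) (hctr : ControllableOn T (LinSystem.const A B C) s₁ s₀) :
    ControllablePair A B := by
  rw [controllablePair_iff, Submodule.eq_top_iff']
  intro y₁
  obtain ⟨v, y, hv, hy, h0, rfl⟩ := hctr 0 y₁
  obtain ⟨X, hX, hXv⟩ := hv.exists_finite hs₁
  refine mem_of_nablaDeriv_sub_mem hT hs₁ hs₀ hs.le (f := y)
    (f' := fun s => A *ᵥ y s + B *ᵥ v s) hy.1 hX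
    (fun t ht h1 h2 h3 => hy.2 t ht h1 h2 (hXv t ht h1 h2 h3))
    (reachableSubspace A B) A.mulVecLin (fun x hx => mulVec_mem_reachableSubspace hx)
    (fun t _ => ?_) ?_
  · rw [mulVecLin_apply, add_sub_cancel_left]
    exact input_mem_reachableSubspace _
  · rw [h0]
    exact Submodule.zero_mem _

theorem observableOn_of_observablePair (h : IsTransitionMatrix T (fun _ => A) Ψ)
    (hT : IsClosed T) (hs₀ : s₀ ∈ T) (hs₁ : s₁ ∈ T)
    (hcard : (n : ℕ∞) ≤ (T ∩ Set.Ioc s₁ s₀).encard) (hAC : ObservablePair A C) :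
    ObservableOn T (LinSystem.const A B C) s₁ s₀ := by
  intro v y y' hv hy hy' hout
  rw [← sub_eq_zero]
  obtain ⟨X, hX, hXv⟩ := hv.exists_finite hs₁
  refine (h.isCocycle hT).eq_zero_of_observablePair hT hs₀ hAC hcard fun r hr h1 h2 ε hε =>
    ⟨r, hr, by linarith, le_rfl, ?_⟩
  have hsub : T ∩ Set.Icc r s₀ ⊆ T ∩ Set.Icc s₁ s₀ :=
    fun t ht => ⟨ht.1, h1.le.trans ht.2.1, ht.2.2⟩
  -- The control cancels in the difference of two solutions; uniqueness, in the form `V = ⊥`,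
  -- identifies it with a free motion despite the discontinuities of `v`.
  have key : y r - y' r - Ψ r s₀ *ᵥ (y s₀ - y' s₀) = 0 := by
    rw [← Submodule.mem_bot ℝ]
    refine mem_of_nablaDeriv_sub_mem hT hr hs₀ h2
      (f := fun s => y s - y' s - Ψ s s₀ *ᵥ (y s₀ - y' s₀))
      (f' := fun s => A *ᵥ (y s - y' s - Ψ s s₀ *ᵥ (y s₀ - y' s₀)))
      (((hy.1.mono hsub).sub (hy'.1.mono hsub)).sub (h.continuousOn_mulVec hs₀ _ r le_rfl))
      hX (fun t ht h3 h4 h5 => ?_) ⊥ A.mulVecLin (by simp) (fun t _ => ?_) ?_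
    · have hrho : rho (T ∩ Set.Icc r s₀) t = rho (T ∩ Set.Icc s₁ s₀) t := by
        rw [rho_inter_Icc hr h3 h4, rho_inter_Icc hs₁ (h1.trans h3) h4]
      have hc := hXv t ht (h1.trans h3) h4 h5
      refine ((((hy.2 t ht (h1.trans h3) h4 hc).mono hsub hrho).sub
        ((hy'.2 t ht (h1.trans h3) h4 hc).mono hsub hrho)).sub
        (h.hasNablaDeriv_mulVec hs₀ _ hr le_rfl ht h3 h4)).congr_deriv ?_
      simp only [LinSystem.const, mulVec_sub]
      abel
    · simp
    · rw [(h s₀ hs₀).1, one_mulVec, sub_self]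
      exact Submodule.zero_mem _
  rw [sub_eq_zero] at key
  rw [← key, mulVec_sub, sub_eq_zero]
  exact hout r hr h1 h2

end Invariance

/-! ### Shrinking a realization whose pair is not observable or not controllable. -/

section Reduction

variable {n n' m p : ℕ} {T : Set ℝ} {A : Matrix (Fin n) (Fin n) ℝ}
  {B : Matrix (Fin n) (Fin m) ℝ} {C : Matrix (Fin p) (Fin n) ℝ}
  {G : ℝ → ℝ → Matrix (Fin p) (Fin m) ℝ}

theorem isLdContinuous_const : (LinSystem.const A B C).IsLdContinuous T :=
  ⟨fun _ _ => ⟨fun _ => continuousWithinAt_const, A, tendsto_const_nhds⟩,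
    fun _ _ => ⟨fun _ => continuousWithinAt_const, B, tendsto_const_nhds⟩,
    fun _ _ => ⟨fun _ => continuousWithinAt_const, C, tendsto_const_nhds⟩⟩

/-- Compression of a realization by `P` and `Q` with `Q * P = 1`. -/
theorem IsRealization.compress (hT : IsClosed T) {Ψ : ℝ → ℝ → Matrix (Fin n) (Fin n) ℝ}
    (h : IsTransitionMatrix T (fun _ => A) Ψ)
    (hG : ∀ s ∈ T, ∀ z ∈ T, s ≤ rho T z → G s z = C * Ψ s (rho T z) * B)
    {P : Matrix (Fin n) (Fin n') ℝ} {Q : Matrix (Fin n') (Fin n) ℝ} (hQP : Q * P = 1)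
    (hA : ∀ s ∈ T, ∀ w ∈ T, s ≤ w → Q * A * P * (Q * Ψ s w * P) = Q * A * Ψ s w * P)
    (hC : ∀ s ∈ T, ∀ w ∈ T, s ≤ w → C * P * (Q * Ψ s w * P) * (Q * B) = C * Ψ s w * B) :
    IsRealization T (LinSystem.const (Q * A * P) (Q * B) (C * P)) G := by
  refine ⟨isLdContinuous_const, fun s w => Q * Ψ s w * P, fun w hw => ⟨?_, ?_, ?_⟩, ?_⟩
  · change Q * Ψ w w * P = 1
    rw [(h w hw).1, Matrix.mul_one, hQP]
  · have hc : Continuous fun M : Matrix (Fin n) (Fin n) ℝ => Q * M * P :=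
      (continuous_const.matrix_mul continuous_id).matrix_mul continuous_const
    exact hc.comp_continuousOn (h w hw).2.1
  · intro s hs hsw hne i j
    have hcol : HasNablaDeriv (T ∩ Set.Iic w) (fun r => Ψ r w *ᵥ P.col j) s
        ((A * Ψ s w) *ᵥ P.col j) := by
      rw [hasNablaDeriv_pi]
      intro i
      exact HasNablaDeriv.sum (I := Finset.univ) (f := fun l r => Ψ r w i l * P l j) fun l _ =>
        ((h w hw).2.2 s hs hsw hne i l).clm_comp ((ContinuousLinearMap.mul ℝ ℝ).flip (P l j))
    have h1 := hasNablaDeriv_pi.1 (hcol.const_mulVec Q) i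
    have e1 : ∀ M : Matrix (Fin n) (Fin n) ℝ, (Q *ᵥ (M *ᵥ P.col j)) i = (Q * M * P) i j := by
      intro M
      rw [mulVec_mulVec]
      rfl
    simp only [e1] at h1
    refine h1.congr_deriv ?_
    simp only [LinSystem.const]
    rw [hA s hs w hw hsw, Matrix.mul_assoc Q A]
  · intro s hs z hz hsz
    rw [hG s hs z hz hsz]
    exact (hC s hs _ (rho_mem hT hz) hsz).symm

theorem exists_smaller_of_not_observablePair (hT : IsClosed T)
    (hG : IsRealization T (LinSystem.const A B C) G) (hAC : ¬ ObservablePair A C) :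
    ∃ n' < n, ∃ (A' : Matrix (Fin n') (Fin n') ℝ) (B' : Matrix (Fin n') (Fin m) ℝ)
      (C' : Matrix (Fin p) (Fin n') ℝ), IsRealization T (LinSystem.const A' B' C') G := by
  obtain ⟨-, Ψ, h, hG⟩ := hG
  set N := unobservableSubspace A C with hN
  rw [observablePair_iff, ← hN] at hAC
  have hdim : Module.finrank ℝ ((Fin n → ℝ) ⧸ N) < n := by
    have h1 := N.finrank_quotient_add_finrank
    have h2 : 0 < Module.finrank ℝ N := by
      rw [pos_iff_ne_zero, ne_eq, Submodule.finrank_eq_zero]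
      exact hAC
    rw [Module.finrank_fin_fun] at h1
    omega
  set n' := Module.finrank ℝ ((Fin n → ℝ) ⧸ N) with hn'
  let e : ((Fin n → ℝ) ⧸ N) ≃ₗ[ℝ] (Fin n' → ℝ) :=
    LinearEquiv.ofFinrankEq _ _ (by rw [Module.finrank_fin_fun])
  let q : (Fin n → ℝ) →ₗ[ℝ] (Fin n' → ℝ) := e.toLinearMap ∘ₗ N.mkQ
  obtain ⟨r, hr⟩ := q.exists_rightInverse_of_surjective
    (LinearMap.range_eq_top.2 (e.surjective.comp N.mkQ_surjective))
  set Q := LinearMap.toMatrix' q with hQ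
  set P := LinearMap.toMatrix' r with hP
  have hQP : Q * P = 1 := by
    rw [hQ, hP, ← LinearMap.toMatrix'_comp, hr, LinearMap.toMatrix'_id]
  have hker : ∀ x, Q *ᵥ x = 0 ↔ x ∈ N := fun x => by
    rw [hQ, LinearMap.toMatrix'_mulVec]
    simp [q]
  have hPQ : ∀ x, x - (P * Q) *ᵥ x ∈ N := fun x => by
    rw [← hker, mulVec_sub, mulVec_mulVec, ← Matrix.mul_assoc, hQP, Matrix.one_mul, sub_self]
  -- `P` is a section of the quotient map `Q`, so a matrix that vanishes on `N = ker Q` does not see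
  -- the projection `P * Q`.
  have absorb : ∀ {k : ℕ} (M : Matrix (Fin k) (Fin n) ℝ), (∀ x ∈ N, M *ᵥ x = 0) →
      M * P * Q = M := by
    intro k M hM
    refine Matrix.mulVec_injective (funext fun x => ?_)
    rw [Matrix.mul_assoc, ← mulVec_mulVec, eq_comm, ← sub_eq_zero, ← mulVec_sub]
    exact hM _ (hPQ x)
  have hC : C * P * Q = C := absorb C fun x hx => by
    simpa using mem_unobservableSubspace.1 hx 0
  have hA : Q * A * P * Q = Q * A := absorb (Q * A) fun x hx => by
    rw [← mulVec_mulVec, hker]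
    exact mulVec_mem_unobservableSubspace hx
  have hΨ : ∀ s ∈ T, ∀ w ∈ T, s ≤ w → Q * Ψ s w * P * Q = Q * Ψ s w := by
    intro s hs w hw hsw
    refine absorb _ fun x hx => ?_
    rw [← mulVec_mulVec, hker]
    exact h.mulVec_mem hT N (fun x hx => mulVec_mem_unobservableSubspace hx) hs hw hsw hx
  refine ⟨n', hdim, _, _, _, IsRealization.compress hT h hG hQP ?_ ?_⟩
  · intro s hs w hw hsw
    rw [← Matrix.mul_assoc, ← Matrix.mul_assoc, hA]
  · intro s hs w hw hsw
    rw [← Matrix.mul_assoc, Matrix.mul_assoc (C * P), hΨ s hs w hw hsw, ← Matrix.mul_assoc, hC]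

theorem exists_smaller_of_not_controllablePair (hT : IsClosed T)
    (hG : IsRealization T (LinSystem.const A B C) G) (hAB : ¬ ControllablePair A B) :
    ∃ n' < n, ∃ (A' : Matrix (Fin n') (Fin n') ℝ) (B' : Matrix (Fin n') (Fin m) ℝ)
      (C' : Matrix (Fin p) (Fin n') ℝ), IsRealization T (LinSystem.const A' B' C') G := by
  obtain ⟨-, Ψ, h, hG⟩ := hG
  set V := reachableSubspace A B with hV
  rw [controllablePair_iff, ← hV] at hAB
  have hdim : Module.finrank ℝ V < n := by
    have := Submodule.finrank_lt hAB
    rwa [Module.finrank_fin_fun] at this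
  set n' := Module.finrank ℝ V with hn'
  let e : (Fin n' → ℝ) ≃ₗ[ℝ] V := LinearEquiv.ofFinrankEq _ _ (by rw [Module.finrank_fin_fun])
  let r : (Fin n' → ℝ) →ₗ[ℝ] (Fin n → ℝ) := V.subtype ∘ₗ e.toLinearMap
  obtain ⟨q, hq⟩ := r.exists_leftInverse_of_injective
    (LinearMap.ker_eq_bot.2 (V.injective_subtype.comp e.injective))
  set Q := LinearMap.toMatrix' q with hQ
  set P := LinearMap.toMatrix' r with hP
  have hQP : Q * P = 1 := by
    rw [hQ, hP, ← LinearMap.toMatrix'_comp, hq, LinearMap.toMatrix'_id]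
  have hPV : ∀ x, P *ᵥ x ∈ V := fun x => by
    rw [hP, LinearMap.toMatrix'_mulVec]
    exact (e x).2
  -- Here `P` embeds `V` and `Q` is a retraction, so `P * Q` is the identity on `V`.
  have absorb : ∀ {k : ℕ} (M : Matrix (Fin n) (Fin k) ℝ), (∀ x, M *ᵥ x ∈ V) →
      P * (Q * M) = M := by
    intro k M hM
    refine Matrix.mulVec_injective (funext fun x => ?_)
    have h1 : P *ᵥ (e.symm ⟨M *ᵥ x, hM x⟩) = M *ᵥ x := by
      rw [hP, LinearMap.toMatrix'_mulVec]
      simp [r]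
    rw [← mulVec_mulVec, ← mulVec_mulVec, ← h1, mulVec_mulVec _ Q, hQP, one_mulVec]
  have hB : P * (Q * B) = B := absorb B fun x => input_mem_reachableSubspace x
  have hΨ : ∀ s ∈ T, ∀ w ∈ T, s ≤ w → P * (Q * (Ψ s w * P)) = Ψ s w * P := by
    intro s hs w hw hsw
    refine absorb _ fun x => ?_
    rw [← mulVec_mulVec]
    exact h.mulVec_mem hT V (fun x hx => mulVec_mem_reachableSubspace hx) hs hw hsw (hPV x)
  refine ⟨n', hdim, _, _, _, IsRealization.compress hT h hG hQP ?_ ?_⟩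
  · intro s hs w hw hsw
    rw [Matrix.mul_assoc (Q * A), Matrix.mul_assoc Q (Ψ s w), hΨ s hs w hw hsw,
      ← Matrix.mul_assoc]
  · intro s hs w hw hsw
    rw [Matrix.mul_assoc C, Matrix.mul_assoc Q (Ψ s w), hΨ s hs w hw hsw, Matrix.mul_assoc C,
      Matrix.mul_assoc (Ψ s w), hB, Matrix.mul_assoc]

end Reduction

end NablaControl

namespace NablaControl

open Matrix

/-! ### Counting points, and the lower bound on the dimension of a realization. -/

section Points

variable {T : Set ℝ} {n : ℕ}

theorem exists_strictMono_of_le_encard {k : ℕ} (h : (k : ℕ∞) ≤ T.encard) :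
    ∃ f : Fin k → ℝ, StrictMono f ∧ ∀ i, f i ∈ T := by
  obtain ⟨F, hFT, hF⟩ := Set.exists_subset_encard_eq h
  have hfin : F.Finite := Set.finite_of_encard_eq_coe hF
  have hcard : hfin.toFinset.card = k := by
    rw [hfin.encard_eq_coe_toFinset_card] at hF
    exact_mod_cast hF
  refine ⟨hfin.toFinset.orderEmbOfFin hcard, OrderEmbedding.strictMono _, fun i => hFT ?_⟩
  exact hfin.mem_toFinset.1 (Finset.orderEmbOfFin_mem _ hcard i)

theorem le_encard_of_injective {S : Set ℝ} {g : Fin n → ℝ} (hg : Function.Injective g)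
    (h : ∀ i, g i ∈ S) : (n : ℕ∞) ≤ S.encard := by
  have h1 := Set.encard_le_encard (Set.range_subset_iff.2 h)
  rwa [← Set.image_univ, hg.encard_image, Set.encard_univ, ENat.card_eq_coe_fintype_card,
    Fintype.card_fin] at h1

theorem exists_middle_point (hn : 0 < n) (h : ((2 * n : ℕ) : ℕ∞) ≤ T.encard) :
    ∃ a : ℝ, ∃ w ∈ T, ∃ b ∈ T, (n : ℕ∞) ≤ (T ∩ Set.Ioc a w).encard ∧
      (n : ℕ∞) ≤ (T ∩ Set.Ico w b).encard := by
  obtain ⟨f, hf, hfT⟩ := exists_strictMono_of_le_encard h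
  -- The point `w` with index `n - 1` counts on both sides, and the last point serves only as `b`;
  -- `a` need not lie in `T`, so the first point counts too.
  refine ⟨f ⟨0, by omega⟩ - 1, _, hfT ⟨n - 1, by omega⟩, _, hfT ⟨2 * n - 1, by omega⟩, ?_, ?_⟩
  · refine le_encard_of_injective (g := fun i => f ⟨i, by omega⟩) (fun i j hij => ?_)
      fun i => ⟨hfT _, ?_, ?_⟩
    · simpa [Fin.ext_iff] using hf.injective hij
    · exact (sub_one_lt _).trans_le (hf.monotone (Fin.mk_le_mk.2 (Nat.zero_le _)))
    · exact hf.monotone (Fin.mk_le_mk.2 (by omega))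
  · refine le_encard_of_injective (g := fun i => f ⟨n - 1 + i, by omega⟩) (fun i j hij => ?_)
      fun i => ⟨hfT _, ?_, ?_⟩
    · simpa [Fin.ext_iff] using hf.injective hij
    · exact hf.monotone (Fin.mk_le_mk.2 (by omega))
    · exact hf (Fin.mk_lt_mk.2 (by omega))

theorem exists_long_interval (h : ((max 2 (2 * n) : ℕ) : ℕ∞) ≤ T.encard) :
    ∃ s₀ ∈ T, ∃ s₁ ∈ T, s₁ < s₀ ∧ (n : ℕ∞) ≤ (T ∩ Set.Ioc s₁ s₀).encard ∧
      (n : ℕ∞) ≤ (T ∩ Set.Ico s₁ s₀).encard := by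
  obtain ⟨f, hf, hfT⟩ := exists_strictMono_of_le_encard h
  refine ⟨_, hfT ⟨max 2 (2 * n) - 1, by omega⟩, _, hfT ⟨0, by omega⟩,
    hf (Fin.mk_lt_mk.2 (by omega)), ?_, ?_⟩
  · refine le_encard_of_injective (g := fun i => f ⟨i + 1, by omega⟩) (fun i j hij => ?_)
      fun i => ⟨hfT _, ?_, ?_⟩
    · simpa [Fin.ext_iff] using hf.injective hij
    · exact hf (Fin.mk_lt_mk.2 (by omega))
    · exact hf.monotone (Fin.mk_le_mk.2 (by omega))
  · refine le_encard_of_injective (g := fun i => f ⟨i, by omega⟩) (fun i j hij => ?_)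
      fun i => ⟨hfT _, ?_, ?_⟩
    · simpa [Fin.ext_iff] using hf.injective hij
    · exact hf.monotone (Fin.mk_le_mk.2 (by omega))
    · exact hf (Fin.mk_lt_mk.2 (by omega))

/-- The pattern is tested only at values of `ρ`, which miss right-dense points that are not
left-dense. Those are approximated from the right, which is why the vanishing criteria above carry
an `ε`. -/
theorem exists_rho_mem_Ico (hT : IsClosed T) {r b ε : ℝ} (hr : r ∈ T) (hb : b ∈ T) (hrb : r < b)
    (hε : 0 < ε) : ∃ z ∈ T, r ≤ rho T z ∧ rho T z < r + ε := by
  by_cases h : (T ∩ Set.Ioo r (r + ε)).Nonempty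
  · obtain ⟨z, hz, h1, h2⟩ := h
    exact ⟨z, hz, le_rho hr h1, (rho_le T z).trans_lt h2⟩
  · rw [Set.not_nonempty_iff_eq_empty] at h
    have hεb : r + ε ≤ b := by
      by_contra! hlt
      exact (Set.eq_empty_iff_forall_notMem.1 h b) ⟨hb, hrb, hlt⟩
    obtain ⟨z, hz, hzmin⟩ :=
      ((isCompact_Icc (a := r + ε) (b := b)).inter_left hT).exists_isLeast ⟨b, hb, hεb, le_rfl⟩
    have hrz : r < z := (lt_add_of_pos_right r hε).trans_le hz.2.1
    have hgap : T ∩ Set.Ioo r z = ∅ := by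
      rw [Set.eq_empty_iff_forall_notMem] at h ⊢
      rintro t ⟨ht, h1, h2⟩
      rcases lt_or_ge t (r + ε) with h3 | h3
      · exact h t ⟨ht, h1, h3⟩
      · exact absurd (hzmin ⟨ht, h3, h2.le.trans hz.2.2⟩) (not_le.2 h2)
    refine ⟨z, hz.1, ?_, ?_⟩ <;> rw [rho_of_gap hr hrz hgap]
    linarith

end Points

section Dimension

variable {n n' m p : ℕ} {T : Set ℝ} {A : Matrix (Fin n) (Fin n) ℝ}
  {B : Matrix (Fin n) (Fin m) ℝ} {C : Matrix (Fin p) (Fin n) ℝ}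
  {G : ℝ → ℝ → Matrix (Fin p) (Fin m) ℝ}

theorem eq_top_of_forall_dotProduct (V : Submodule ℝ (Fin n → ℝ))
    (h : ∀ x : Fin n → ℝ, (∀ y ∈ V, x ⬝ᵥ y = 0) → x = 0) : V = ⊤ := by
  by_contra hV
  obtain ⟨f, hf, hVf⟩ := V.exists_le_ker_of_lt_top (lt_top_iff_ne_top.2 hV)
  have hfx : ∀ y, f y = (fun i => f (Pi.single i 1)) ⬝ᵥ y := by
    intro y
    rw [LinearMap.pi_apply_eq_sum_univ f y, dotProduct]
    refine Finset.sum_congr rfl fun i _ => ?_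
    rw [smul_eq_mul, mul_comm]
    congr 2
    ext j
    simp [Pi.single_apply, eq_comm]
  have h0 := h (fun i => f (Pi.single i 1)) fun y hy => (hfx y).symm.trans (hVf hy)
  refine hf (LinearMap.ext fun y => ?_)
  rw [hfx, h0, zero_dotProduct, LinearMap.zero_apply]

theorem dimension_le_of_isRealization (hT : IsClosed T)
    (hcard : ((2 * n : ℕ) : ℕ∞) ≤ T.encard) (hG : IsRealization T (LinSystem.const A B C) G)
    (hAB : ControllablePair A B) (hAC : ObservablePair A C) {Λ : LinSystem n' m p}
    (hΛ : IsRealization T Λ G) : n ≤ n' := by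
  rcases Nat.eq_zero_or_pos n with rfl | hn
  · exact Nat.zero_le _
  obtain ⟨-, Ψ, h, hG⟩ := hG
  obtain ⟨hld, Ψ', h', hG'⟩ := hΛ
  obtain ⟨a, w, hw, b, hb, haw, hwb⟩ := exists_middle_point hn hcard
  have hΨ := h.isCocycle hT
  let ι := {s : ℝ // s ∈ T ∧ s ≤ w}
  let O : (Fin n → ℝ) →ₗ[ℝ] (ι → Fin p → ℝ) :=
    LinearMap.pi fun s => (C * Ψ s w).mulVecLin
  let O' : (Fin n' → ℝ) →ₗ[ℝ] (ι → Fin p → ℝ) :=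
    LinearMap.pi fun s => (Λ.C s * Ψ' s w).mulVecLin
  have hO : Function.Injective O := by
    rw [← LinearMap.ker_eq_bot, Submodule.eq_bot_iff]
    intro x hx
    refine hΨ.eq_zero_of_observablePair hT hw hAC haw fun r hr h1 h2 ε hε =>
      ⟨r, hr, by linarith, le_rfl, ?_⟩
    have := congrFun (LinearMap.mem_ker.1 hx) ⟨r, hr, h2⟩
    rw [mulVec_mulVec]
    exact this
  -- For `x = Ψ(w, ρ(z)) B u` the outputs `O x` are the pattern applied to `u`, which the other
  -- realization also produces; a covector that kills all such `x` is zero by controllability.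
  have hspan : (LinearMap.range O').comap O = ⊤ := by
    refine eq_top_of_forall_dotProduct _ fun x hx => ?_
    refine hΨ.eq_zero_of_controllablePair hT hw hAB hwb fun r hr h1 h2 ε hε => ?_
    obtain ⟨z, hz, h3, h4⟩ := exists_rho_mem_Ico hT hr hb h2 hε
    refine ⟨rho T z, rho_mem hT hz, h3, h4, ?_⟩
    have hwz : w ≤ rho T z := h1.trans h3
    refine dotProduct_eq _ _ fun u => ?_
    rw [zero_dotProduct, ← dotProduct_mulVec]
    refine hx _ ?_
    refine ⟨(Ψ' w (rho T z) * Λ.B z) *ᵥ u, funext fun s => ?_⟩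
    have h5 := hG s s.2.1 z hz (s.2.2.trans hwz)
    have h6 := hG' s s.2.1 z hz (s.2.2.trans hwz)
    rw [← h'.mul hT hld.1 s.2.1 hw (rho_mem hT hz) s.2.2 hwz] at h6
    rw [← hΨ.mul s s.2.1 w hw _ (rho_mem hT hz) s.2.2 hwz] at h5
    change (Λ.C s * Ψ' s w) *ᵥ ((Ψ' w (rho T z) * Λ.B z) *ᵥ u) =
      (C * Ψ s w) *ᵥ ((Ψ w (rho T z) * B) *ᵥ u)
    rw [mulVec_mulVec, mulVec_mulVec]
    congr 1
    have e1 : Λ.C s * Ψ' s w * (Ψ' w (rho T z) * Λ.B z) = G s z := by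
      rw [h6]; simp only [Matrix.mul_assoc]
    have e2 : C * Ψ s w * (Ψ w (rho T z) * B) = G s z := by
      rw [h5]; simp only [LinSystem.const, Matrix.mul_assoc]
    rw [e1, e2]
  have hle : LinearMap.range O ≤ LinearMap.range O' := by
    rintro _ ⟨x, rfl⟩
    exact (hspan ▸ Submodule.mem_top : x ∈ (LinearMap.range O').comap O)
  have h1 := Submodule.finrank_mono hle
  rw [LinearMap.finrank_range_of_inj hO, Module.finrank_fin_fun] at h1
  exact h1.trans ((LinearMap.finrank_range_le O').trans_eq (Module.finrank_fin_fun ℝ))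

end Dimension

end NablaControl

namespace NablaControl

open Matrix MeasureTheory

/-! ### From continuous inputs on the real line to controls on `T`. -/

section GapAverage

variable {E : Type*} [NormedAddCommGroup E] [NormedSpace ℝ E] {T : Set ℝ} {s : ℝ}

theorem rho_mono (T : Set ℝ) : Monotone (rho T) := by
  intro q q' hqq'
  by_cases h : (T ∩ Set.Iio q).Nonempty
  · have hbdd : BddAbove (T ∩ Set.Iio q') := ⟨q', fun t ht => ht.2.le⟩
    have hsub : T ∩ Set.Iio q ⊆ T ∩ Set.Iio q' := fun t ht => ⟨ht.1, ht.2.trans_le hqq'⟩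
    rw [rho, rho, if_pos h, if_pos (h.mono hsub)]
    exact csSup_le_csSup hbdd h hsub
  · refine (rho_le T q).trans ?_
    by_cases h' : (T ∩ Set.Iio q').Nonempty
    · obtain ⟨t, ht, htq'⟩ := h'
      have hqt : q ≤ t := by
        by_contra! hlt
        exact h ⟨t, ht, hlt⟩
      exact hqt.trans (le_rho ht htq')
    · rw [rho, if_neg h']
      exact hqq'

theorem rho_mem_of_lt (hT : IsClosed T) {t q : ℝ} (ht : t ∈ T) (htq : t < q) : rho T q ∈ T := by
  have h : (T ∩ Set.Iio q).Nonempty := ⟨t, ht, htq⟩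
  rw [rho, if_pos h]
  exact hT.closure_subset_iff.2 Set.inter_subset_left
    (csSup_mem_closure h ⟨q, fun t ht => ht.2.le⟩)

/-- The mean of `g` over the gap to the left of `z`, or `g z` if there is none. -/
noncomputable def gapAverage (T : Set ℝ) (g : ℝ → E) (z : ℝ) : E :=
  if rho T z < z then (z - rho T z)⁻¹ • ∫ r in rho T z..z, g r else g z

theorem gapAverage_of_rho_eq {g : ℝ → E} (h : rho T s = s) : gapAverage T g s = g s := by
  rw [gapAverage, if_neg (by rw [h]; exact lt_irrefl s)]

theorem smul_gapAverage {g : ℝ → E} (h : rho T s < s) :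
    (s - rho T s) • gapAverage T g s = ∫ r in rho T s..s, g r := by
  rw [gapAverage, if_pos h, smul_smul, mul_inv_cancel₀ (by linarith), one_smul]

/-- Continuity is needed because `s` may be right-dense; the strict inequality at `t = s` then
persists nearby. -/
theorem hasNablaDeriv_of_gap {f : ℝ → E} {L : E} (hs : rho T s < s)
    (hf : ContinuousWithinAt f T s) (h : f (rho T s) = f s - (s - rho T s) • L) :
    HasNablaDeriv T f s L := by
  intro ε hε
  have hc : ContinuousWithinAt (fun t => ‖f (rho T s) - f t - (rho T s - t) • L‖ -
      ε * |rho T s - t|) T s := by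
    refine ContinuousWithinAt.sub (ContinuousWithinAt.norm ?_) ?_
    · exact (continuousWithinAt_const.sub hf).sub
        (Continuous.continuousWithinAt (by fun_prop))
    · exact Continuous.continuousWithinAt (by fun_prop)
  have h0 : ‖f (rho T s) - f s - (rho T s - s) • L‖ - ε * |rho T s - s| < 0 := by
    have : f (rho T s) - f s - (rho T s - s) • L = 0 := by
      rw [h, ← neg_sub s (rho T s), neg_smul]; abel
    rw [this, norm_zero, zero_sub, neg_lt_zero]
    exact mul_pos hε (abs_pos.2 (by linarith))
  filter_upwards [hc.tendsto.eventually_lt_const h0] with t ht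
  linarith

variable [CompleteSpace E]

theorem norm_gapAverage_sub_le {g : ℝ → E} (hg : Continuous g) {z ε : ℝ} {c : E}
    (h : ∀ r, rho T z ≤ r → r ≤ z → ‖g r - c‖ ≤ ε) : ‖gapAverage T g z - c‖ ≤ ε := by
  rcases (rho_le T z).eq_or_lt with hz | hz
  · rw [gapAverage_of_rho_eq hz]
    exact h z (rho_le T z) le_rfl
  · have hpos : 0 < z - rho T z := by linarith
    have h1 : (z - rho T z) • (gapAverage T g z - c) = ∫ r in rho T z..z, (g r - c) := by
      rw [smul_sub, smul_gapAverage hz, intervalIntegral.integral_sub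
        (hg.intervalIntegrable _ _) intervalIntegrable_const, intervalIntegral.integral_const]
    have h2 : ‖∫ r in rho T z..z, (g r - c)‖ ≤ ε * |z - rho T z| := by
      refine intervalIntegral.norm_integral_le_of_norm_le_const fun r hr => ?_
      rw [Set.uIoc_of_le hz.le] at hr
      exact h r hr.1.le hr.2
    rw [← h1, norm_smul, Real.norm_eq_abs, mul_comm] at h2
    exact le_of_mul_le_mul_right h2 (abs_pos.2 hpos.ne')

/-- Gaps ending at points near `s` lie near `s`. The point `s` is excluded because its own left gap
need not be short. -/
theorem tendsto_gapAverage {g : ℝ → E} (hg : Continuous g) (hs : s ∈ T) :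
    Tendsto (gapAverage T g) (𝓝[T \ {s}] s) (𝓝 (g s)) := by
  rw [Metric.tendsto_nhds]
  intro ε hε
  obtain ⟨δ, hδ, hgδ⟩ := Metric.continuous_iff.1 hg s (ε / 2) (by positivity)
  have hclose : ∀ r, |r - s| < δ → ‖g r - g s‖ ≤ ε / 2 := fun r hr => by
    rw [← dist_eq_norm]
    exact (hgδ r (by rwa [Real.dist_eq])).le
  have hleft : ∃ c < s, ∀ t ∈ T, c < t → t < s → s - δ < rho T t := by
    by_cases h : (T ∩ Set.Ioo (s - δ) s).Nonempty
    · obtain ⟨c, hc, h1, h2⟩ := h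
      exact ⟨c, h2, fun t ht hct hts => h1.trans_le (le_rho hc hct)⟩
    · rw [Set.not_nonempty_iff_eq_empty] at h
      exact ⟨s - δ, by linarith, fun t ht h1 h2 =>
        absurd ⟨ht, h1, h2⟩ (Set.eq_empty_iff_forall_notMem.1 h t)⟩
  obtain ⟨c, hcs, hc⟩ := hleft
  have h1 : ∀ᶠ t in 𝓝[T \ {s}] s, c < t := (lt_mem_nhds hcs).filter_mono nhdsWithin_le_nhds
  have h2 : ∀ᶠ t in 𝓝[T \ {s}] s, t < s + δ :=
    (gt_mem_nhds (by linarith : s < s + δ)).filter_mono nhdsWithin_le_nhds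
  filter_upwards [self_mem_nhdsWithin, h1, h2] with t ht hct htδ
  rw [dist_eq_norm]
  refine (norm_gapAverage_sub_le hg fun r hr1 hr2 => hclose r ?_).trans_lt (half_lt_self hε)
  have h3 : s - δ < rho T t := by
    rcases lt_or_gt_of_ne ht.2 with h | h
    · exact hc t ht.1 hct h
    · exact (by linarith : s - δ < s).trans_le (le_rho hs h)
  rw [abs_lt]
  constructor <;> linarith

theorem piecewiseLdContinuous_gapAverage {g : ℝ → E} (hg : Continuous g) {s₁ s₀ : ℝ}
    (hs₁ : s₁ ∈ T) : PiecewiseLdContinuous (T ∩ Set.Icc s₁ s₀) (gapAverage T g) := by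
  refine ⟨fun s hs => ⟨⟨g s, ?_⟩, ⟨g s, ?_⟩⟩, ?_⟩
  · refine (tendsto_gapAverage hg hs.1).mono_left (nhdsWithin_mono _ ?_)
    exact fun t ht => ⟨ht.1.1, ne_of_lt ht.2⟩
  · refine (tendsto_gapAverage hg hs.1).mono_left (nhdsWithin_mono _ ?_)
    exact fun t ht => ⟨ht.1.1, ne_of_gt ht.2⟩
  · convert Set.finite_empty
    rw [Set.eq_empty_iff_forall_notMem]
    rintro s ⟨hs, hld, hnc⟩
    rcases hs.2.1.eq_or_lt with h | h
    · obtain ⟨t, ht, hts⟩ := hld.1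
      exact absurd (Set.mem_Iio.1 hts) (not_lt.2 (h ▸ ht.2.1))
    · rw [leftDense_inter_Icc_iff hs₁ h hs.2.2] at hld
      refine hnc ?_
      have h1 := tendsto_gapAverage hg hs.1
      rw [← gapAverage_of_rho_eq (g := g) hld.2] at h1
      exact (continuousWithinAt_sdiff_self.1 h1).mono Set.inter_subset_left

end GapAverage

/-! ### The forced response and steering for a controllable pair. -/

section Steering

variable {n m p : ℕ} {T : Set ℝ} {A : Matrix (Fin n) (Fin n) ℝ}
  {Φ : ℝ → ℝ → Matrix (Fin n) (Fin n) ℝ} {s₁ s₀ : ℝ} {β : ℝ → Fin n → ℝ}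

/-- The map is Lipschitz on the part of `T` in `[s, b]`. Composing the extension with the monotone
`rho` makes the integrand of the forced response measurable. -/
theorem IsCocycle.exists_continuous_extension (h : IsCocycle T A Φ) {s : ℝ} (hs : s ∈ T) (b : ℝ)
    (x : Fin n → ℝ) :
    ∃ F : ℝ → Fin n → ℝ, Continuous F ∧ ∀ w ∈ T, s ≤ w → w ≤ b → Φ s w *ᵥ x = F w := by
  obtain ⟨K, hK, hest⟩ := h.norm_sub_le s b
  by_cases hsb : s ≤ b
  swap
  · exact ⟨fun _ => 0, continuous_const, fun w _ h1 h2 => absurd (h1.trans h2) hsb⟩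
  have hD : 0 ≤ b - s := by linarith
  have hbound : ∀ w ∈ T, s ≤ w → w ≤ b → ∀ y, ‖Φ s w *ᵥ y‖ ≤ (K * (b - s) + 1) * ‖y‖ := by
    intro w hw hsw hwb y
    have h1 := hest s hs w hw le_rfl hsw hwb y
    have h2 : ‖Φ s w *ᵥ y‖ ≤ ‖Φ s w *ᵥ y - y‖ + ‖y‖ := by
      simpa using norm_add_le (Φ s w *ᵥ y - y) y
    have h3 : K * (w - s) * ‖y‖ ≤ K * (b - s) * ‖y‖ := by gcongr
    linarith
  set L : ℝ := (K * (b - s) + 1) * (K * ‖x‖) with hL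
  have hL0 : 0 ≤ L := by positivity
  have hstep : ∀ w ∈ T ∩ Set.Icc s b, ∀ w' ∈ T ∩ Set.Icc s b, w ≤ w' →
      dist (Φ s w *ᵥ x) (Φ s w' *ᵥ x) ≤ L * dist w w' := by
    intro w hw w' hw' hww'
    rw [dist_comm, dist_eq_norm, dist_comm w, Real.dist_eq, abs_of_nonneg (by linarith),
      ← h.mul s hs w hw.1 w' hw'.1 hw.2.1 hww', ← mulVec_mulVec, ← mulVec_sub]
    have h1 := hest w hw.1 w' hw'.1 hw.2.1 hww' hw'.2.2 x
    refine (hbound w hw.1 hw.2.1 hw.2.2 _).trans ?_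
    calc (K * (b - s) + 1) * ‖Φ w w' *ᵥ x - x‖ ≤
          (K * (b - s) + 1) * (K * (w' - w) * ‖x‖) := by gcongr
      _ = L * (w' - w) := by rw [hL]; ring
  have hlip : LipschitzOnWith ⟨L, hL0⟩ (fun w => Φ s w *ᵥ x) (T ∩ Set.Icc s b) := by
    refine LipschitzOnWith.of_dist_le_mul fun w hw w' hw' => ?_
    rcases le_total w w' with h1 | h1
    · exact hstep w hw w' hw' h1
    · rw [dist_comm, dist_comm w]
      exact hstep w' hw' w hw h1
  obtain ⟨F, hF, hFe⟩ := hlip.extend_pi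
  exact ⟨F, hF.continuous, fun w hw h1 h2 => hFe ⟨hw, h1, h2⟩⟩

theorem IsCocycle.intervalIntegrable (hT : IsClosed T) (h : IsCocycle T A Φ) {s b : ℝ}
    (hs : s ∈ T) (hsb : s ≤ b) (hβ : Continuous β) :
    IntervalIntegrable (fun r => Φ s (rho T r) *ᵥ β r) volume s b := by
  choose F hF hFe using fun j : Fin n => h.exists_continuous_extension hs b (Pi.single j 1)
  have hint : ∀ j, IntervalIntegrable (fun r => F j (rho T r)) volume s b := by
    intro j
    rw [intervalIntegrable_iff_integrableOn_Ioc_of_le hsb]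
    obtain ⟨K, hK⟩ := (isCompact_Icc (a := s) (b := b)).exists_bound_of_continuousOn
      (hF j).continuousOn
    refine Measure.integrableOn_of_bounded (M := K) (by simp)
      ((hF j).measurable.comp (rho_mono T).measurable).aestronglyMeasurable ?_
    refine (ae_restrict_iff' measurableSet_Ioc).2 (Eventually.of_forall fun r hr => ?_)
    exact hK _ ⟨le_rho hs hr.1, (rho_le T r).trans hr.2⟩
  have hsum : IntervalIntegrable (fun r => ∑ j, β r j • F j (rho T r)) volume s b := by
    have := IntervalIntegrable.sum (μ := volume) (a := s) (b := b) Finset.univ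
      (f := fun j r => β r j • F j (rho T r)) fun j _ =>
        (hint j).continuousOn_smul ((continuous_apply j).comp hβ).continuousOn
    exact this.congr fun r _ => by simp [Finset.sum_apply]
  refine hsum.congr fun r hr => ?_
  rw [Set.uIoc_of_le hsb] at hr
  have hr' := fun j => hFe j (rho T r) (rho_mem_of_lt hT hs hr.1) (le_rho hs hr.1)
    ((rho_le T r).trans hr.2)
  simp only [← hr', ← mulVec_smul, ← mulVec_sum]
  congr 1
  ext i
  simp [Finset.sum_apply, Pi.single_apply]

/-- The forced response that vanishes at `s₀`. -/
noncomputable def forcedResponse (T : Set ℝ) (Φ : ℝ → ℝ → Matrix (Fin n) (Fin n) ℝ) (s₀ : ℝ)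
    (β : ℝ → Fin n → ℝ) (s : ℝ) : Fin n → ℝ :=
  -∫ r in s..s₀, Φ s (rho T r) *ᵥ β r

theorem IsCocycle.forcedResponse_eq (hT : IsClosed T) (h : IsCocycle T A Φ) (hβ : Continuous β)
    {t s : ℝ} (ht : t ∈ T) (hs : s ∈ T) (hts : t ≤ s) (hs₀ : s ≤ s₀) :
    forcedResponse T Φ s₀ β t = Φ t s *ᵥ forcedResponse T Φ s₀ β s -
      ∫ r in t..s, Φ t (rho T r) *ᵥ β r := by
  have h1 := h.intervalIntegrable hT ht (hts.trans hs₀) hβ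
  have hts0 : s ∈ Set.uIcc t s₀ := by rw [Set.uIcc_of_le (hts.trans hs₀)]; exact ⟨hts, hs₀⟩
  rw [forcedResponse, ← intervalIntegral.integral_add_adjacent_intervals
    (h1.mono_set (Set.uIcc_subset_uIcc_left hts0)) (h1.mono_set (Set.uIcc_subset_uIcc_right hts0))]
  have h2 : ∫ r in s..s₀, Φ t (rho T r) *ᵥ β r =
      Φ t s *ᵥ ∫ r in s..s₀, Φ s (rho T r) *ᵥ β r := by
    have := ContinuousLinearMap.intervalIntegral_comp_comm
      (LinearMap.toContinuousLinearMap (Φ t s).mulVecLin) (h.intervalIntegrable hT hs hs₀ hβ)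
    refine Eq.trans (intervalIntegral.integral_congr_ae (Eventually.of_forall fun r hr => ?_)) this
    rw [Set.uIoc_of_le hs₀] at hr
    change _ = Φ t s *ᵥ (Φ s (rho T r) *ᵥ β r)
    rw [mulVec_mulVec, h.mul t ht s hs _ (rho_mem_of_lt hT hs hr.1) hts (le_rho hs hr.1)]
  rw [h2, forcedResponse, mulVec_neg]
  abel

/-- The equation in integrated form, up to second order: `forcedResponse_eq` with the transition
matrix expanded and the kernel replaced by `1`. -/
theorem IsCocycle.norm_forcedResponse_sub_le (hT : IsClosed T) (h : IsCocycle T A Φ)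
    (hβ : Continuous β) (s₁ s₀ : ℝ) :
    ∃ K, 0 ≤ K ∧ ∀ t ∈ T, ∀ s ∈ T, s₁ ≤ t → t ≤ s → s ≤ s₀ →
      ‖forcedResponse T Φ s₀ β t - forcedResponse T Φ s₀ β s +
        (s - t) • (A *ᵥ forcedResponse T Φ s₀ β s) + ∫ r in t..s, β r‖ ≤ K * (s - t) ^ 2 := by
  by_cases hle : s₁ ≤ s₀
  swap
  · exact ⟨0, le_rfl, fun t _ s _ h1 h2 h3 => absurd (h1.trans (h2.trans h3)) hle⟩
  have hD : 0 ≤ s₀ - s₁ := by linarith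
  obtain ⟨K₁, hK₁, hest₁⟩ := h.norm_sub_le s₁ s₀
  obtain ⟨K₂, hK₂, hest₂⟩ := h.norm_sub_add_le s₁ s₀
  obtain ⟨Mβ, hMβ⟩ := (isCompact_Icc (a := s₁) (b := s₀)).exists_bound_of_continuousOn
    hβ.continuousOn
  have hMβ0 : 0 ≤ Mβ := (norm_nonneg _).trans (hMβ s₁ ⟨le_rfl, hle⟩)
  have hkernel : ∀ t ∈ T, ∀ s, s₁ ≤ t → t ≤ s → s ≤ s₀ →
      ‖(∫ r in t..s, Φ t (rho T r) *ᵥ β r) - ∫ r in t..s, β r‖ ≤ K₁ * Mβ * (s - t) ^ 2 := by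
    intro t ht s h1 h2 h3
    rw [← intervalIntegral.integral_sub (h.intervalIntegrable hT ht h2 hβ)
      (hβ.intervalIntegrable _ _)]
    have := intervalIntegral.norm_integral_le_of_norm_le_const (a := t) (b := s)
      (f := fun r => Φ t (rho T r) *ᵥ β r - β r) (C := K₁ * (s - t) * Mβ) fun r hr => by
        rw [Set.uIoc_of_le h2] at hr
        have h4 := rho_le T r
        have h5 := le_rho ht hr.1
        refine (hest₁ t ht _ (rho_mem_of_lt hT ht hr.1) h1 h5
          (h4.trans (hr.2.trans h3)) (β r)).trans ?_
        have h6 := hMβ r ⟨h1.trans hr.1.le, hr.2.trans h3⟩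
        have h7 : rho T r - t ≤ s - t := by linarith [hr.2]
        have h8 : 0 ≤ rho T r - t := by linarith
        gcongr
    rw [abs_of_nonneg (by linarith)] at this
    exact this.trans (le_of_eq (by ring))
  have hY : ∀ s ∈ T, s₁ ≤ s → s ≤ s₀ →
      ‖forcedResponse T Φ s₀ β s‖ ≤ K₁ * Mβ * (s₀ - s₁) ^ 2 + Mβ * (s₀ - s₁) := by
    intro s hs h1 h2
    rw [forcedResponse, norm_neg]
    have h3 := hkernel s hs s₀ h1 h2 le_rfl
    have h4 := intervalIntegral.norm_integral_le_of_norm_le_const (a := s) (b := s₀)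
      (f := β) (C := Mβ) fun r hr => by
        rw [Set.uIoc_of_le h2] at hr
        exact hMβ r ⟨h1.trans hr.1.le, hr.2⟩
    rw [abs_of_nonneg (by linarith)] at h4
    have h5 : K₁ * Mβ * (s₀ - s) ^ 2 ≤ K₁ * Mβ * (s₀ - s₁) ^ 2 := by
      have : 0 ≤ s₀ - s := by linarith
      gcongr
    have h6 : Mβ * (s₀ - s) ≤ Mβ * (s₀ - s₁) := by gcongr
    have h7 := norm_add_le ((∫ r in s..s₀, Φ s (rho T r) *ᵥ β r) - ∫ r in s..s₀, β r)
      (∫ r in s..s₀, β r)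
    rw [sub_add_cancel] at h7
    linarith
  set Y := K₁ * Mβ * (s₀ - s₁) ^ 2 + Mβ * (s₀ - s₁) with hYdef
  have hY0 : 0 ≤ Y := by positivity
  refine ⟨K₂ * Y + K₁ * Mβ, by positivity, fun t ht s hs h1 h2 h3 => ?_⟩
  rw [h.forcedResponse_eq hT hβ ht hs h2 h3]
  have e : Φ t s *ᵥ forcedResponse T Φ s₀ β s - (∫ r in t..s, Φ t (rho T r) *ᵥ β r) -
      forcedResponse T Φ s₀ β s + (s - t) • (A *ᵥ forcedResponse T Φ s₀ β s) +
      ∫ r in t..s, β r =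
      (Φ t s *ᵥ forcedResponse T Φ s₀ β s - forcedResponse T Φ s₀ β s +
        (s - t) • (A *ᵥ forcedResponse T Φ s₀ β s)) -
      ((∫ r in t..s, Φ t (rho T r) *ᵥ β r) - ∫ r in t..s, β r) := by abel
  rw [e]
  refine (_root_.norm_sub_le _ _).trans ?_
  have h4 := hest₂ t ht s hs h1 h2 h3 (forcedResponse T Φ s₀ β s)
  have h5 : K₂ * (s - t) ^ 2 * ‖forcedResponse T Φ s₀ β s‖ ≤ K₂ * (s - t) ^ 2 * Y := by
    have := hY s hs (h1.trans h2) h3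
    gcongr
  have h6 := hkernel t ht s h1 h2 h3
  linarith

theorem IsCocycle.forcedResponse_isSolution (hT : IsClosed T) (h : IsCocycle T A Φ)
    (hβ : Continuous β) (hs₁ : s₁ ∈ T) (hs₀ : s₀ ∈ T) (hle : s₁ ≤ s₀) :
    ContinuousOn (forcedResponse T Φ s₀ β) (T ∩ Set.Icc s₁ s₀) ∧
    ∀ s ∈ T, s₁ < s → s ≤ s₀ → HasNablaDeriv (T ∩ Set.Icc s₁ s₀) (forcedResponse T Φ s₀ β) s
      (A *ᵥ forcedResponse T Φ s₀ β s + gapAverage T β s) := by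
  set y := forcedResponse T Φ s₀ β with hy
  obtain ⟨K, hK, hest⟩ := h.norm_forcedResponse_sub_le hT hβ s₁ s₀
  obtain ⟨M, hM, hA⟩ := exists_norm_mulVec_le A
  have hD : 0 ≤ s₀ - s₁ := by linarith
  obtain ⟨Mβ, hMβ⟩ := (isCompact_Icc (a := s₁) (b := s₀)).exists_bound_of_continuousOn
    hβ.continuousOn
  have hMβ0 : 0 ≤ Mβ := (norm_nonneg _).trans (hMβ s₁ ⟨le_rfl, hle⟩)
  have hintβ : ∀ t s, s₁ ≤ t → t ≤ s → s ≤ s₀ → ‖∫ r in t..s, β r‖ ≤ Mβ * (s - t) := by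
    intro t s h1 h2 h3
    have := intervalIntegral.norm_integral_le_of_norm_le_const (a := t) (b := s)
      (f := β) (C := Mβ) fun r hr => by
        rw [Set.uIoc_of_le h2] at hr
        exact hMβ r ⟨h1.trans hr.1.le, hr.2.trans h3⟩
    rwa [abs_of_nonneg (by linarith)] at this
  have hincr : ∀ t ∈ T, ∀ s ∈ T, s₁ ≤ t → t ≤ s → s ≤ s₀ →
      ‖y t - y s‖ ≤ (M * ‖y s‖ + Mβ + K * (s₀ - s₁)) * (s - t) := by
    intro t ht s hs h1 h2 h3
    have h4 := hest t ht s hs h1 h2 h3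
    have e : y t - y s = (y t - y s + (s - t) • (A *ᵥ y s) + ∫ r in t..s, β r) -
        ((s - t) • (A *ᵥ y s) + ∫ r in t..s, β r) := by abel
    rw [e]
    refine (_root_.norm_sub_le _ _).trans ?_
    have h5 : ‖(s - t) • (A *ᵥ y s) + ∫ r in t..s, β r‖ ≤
        (s - t) * (M * ‖y s‖) + Mβ * (s - t) := by
      refine (norm_add_le _ _).trans (add_le_add ?_ (hintβ t s h1 h2 h3))
      rw [norm_smul, Real.norm_of_nonneg (by linarith)]
      exact mul_le_mul_of_nonneg_left (hA _) (by linarith)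
    have h6 : K * (s - t) ^ 2 ≤ K * (s₀ - s₁) * (s - t) := by
      rw [pow_two, ← mul_assoc]
      refine mul_le_mul_of_nonneg_right (mul_le_mul_of_nonneg_left (by linarith) hK) (by linarith)
    linarith
  have hY : ∃ Y, 0 ≤ Y ∧ ∀ s ∈ T, s₁ ≤ s → s ≤ s₀ → ‖y s‖ ≤ Y := by
    refine ⟨‖y s₀‖ + (M * ‖y s₀‖ + Mβ + K * (s₀ - s₁)) * (s₀ - s₁), by positivity,
      fun s hs h1 h2 => ?_⟩
    have h3 := hincr s hs s₀ hs₀ h1 h2 le_rfl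
    have h4 : ‖y s‖ ≤ ‖y s - y s₀‖ + ‖y s₀‖ := by simpa using norm_add_le (y s - y s₀) (y s₀)
    have h5 : (M * ‖y s₀‖ + Mβ + K * (s₀ - s₁)) * (s₀ - s) ≤
        (M * ‖y s₀‖ + Mβ + K * (s₀ - s₁)) * (s₀ - s₁) := by gcongr
    linarith
  obtain ⟨Y, hY0, hY⟩ := hY
  set K₂ := M * Y + Mβ + K * (s₀ - s₁) with hK₂
  have hK₂0 : 0 ≤ K₂ := by positivity
  have hlip : ∀ t ∈ T, ∀ s ∈ T, s₁ ≤ t → t ≤ s → s ≤ s₀ → ‖y t - y s‖ ≤ K₂ * (s - t) := by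
    intro t ht s hs h1 h2 h3
    refine (hincr t ht s hs h1 h2 h3).trans (mul_le_mul_of_nonneg_right ?_ (by linarith))
    have := mul_le_mul_of_nonneg_left (hY s hs (h1.trans h2) h3) hM
    linarith
  have hcont : ContinuousOn y (T ∩ Set.Icc s₁ s₀) := by
    have : LipschitzOnWith ⟨K₂, hK₂0⟩ y (T ∩ Set.Icc s₁ s₀) := by
      refine LipschitzOnWith.of_dist_le_mul fun t ht s hs => ?_
      rw [dist_eq_norm, Real.dist_eq]
      rcases le_total t s with h1 | h1
      · rw [abs_sub_comm, abs_of_nonneg (by linarith)]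
        exact hlip t ht.1 s hs.1 ht.2.1 h1 hs.2.2
      · rw [abs_of_nonneg (by linarith), norm_sub_rev]
        exact hlip s hs.1 t ht.1 hs.2.1 h1 ht.2.2
    exact this.continuousOn
  refine ⟨hcont, fun s hs h1 h2 => ?_⟩
  rcases (rho_le T s).eq_or_lt with hd | hgap
  · rw [gapAverage_of_rho_eq hd, hasNablaDeriv_iff_isLittleO, rho_inter_Icc hs₁ h1 h2, hd]
    have hquad : (fun t => y s - y t - (s - t) • (A *ᵥ y s) - ∫ r in t..s, β r)
        =O[𝓝[T ∩ Set.Icc s₁ s₀] s] fun t => (s - t) ^ 2 := by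
      refine Asymptotics.IsBigO.of_bound (K + M * K₂) ?_
      filter_upwards [self_mem_nhdsWithin] with t ht
      rw [Real.norm_of_nonneg (sq_nonneg _)]
      rcases le_total t s with h3 | h3
      · have h4 := hest t ht.1 s hs ht.2.1 h3 h2
        rw [← norm_neg] at h4
        have e : -(y t - y s + (s - t) • (A *ᵥ y s) + ∫ r in t..s, β r) =
          y s - y t - (s - t) • (A *ᵥ y s) - ∫ r in t..s, β r := by abel
        rw [e] at h4
        refine h4.trans (mul_le_mul_of_nonneg_right ?_ (sq_nonneg _))
        have := mul_nonneg hM hK₂0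
        linarith
      · have h4 := hest s hs t ht.1 h1.le h3 ht.2.2
        -- For `t` to the right of `s` the expansion is centred at `t`; moving the centre to `s`
        -- costs another quadratic term.
        have e : y s - y t - (s - t) • (A *ᵥ y s) - ∫ r in t..s, β r =
            (y s - y t + (t - s) • (A *ᵥ y t) + ∫ r in s..t, β r) +
            (t - s) • (A *ᵥ (y s - y t)) := by
          rw [intervalIntegral.integral_symm, mulVec_sub, smul_sub, ← neg_sub t s, neg_smul]
          abel
        rw [e]
        refine (norm_add_le _ _).trans ?_
        rw [norm_smul, Real.norm_of_nonneg (by linarith)]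
        have h5 := mul_le_mul_of_nonneg_left
          ((hA (y s - y t)).trans (mul_le_mul_of_nonneg_left
            (hlip s hs t ht.1 h1.le h3 ht.2.2) hM)) (by linarith : 0 ≤ t - s)
        have e2 : (K + M * K₂) * (s - t) ^ 2 =
          K * (t - s) ^ 2 + (t - s) * (M * (K₂ * (t - s))) := by ring
        linarith
    have hsq : (fun t : ℝ => (s - t) ^ 2) =o[𝓝[T ∩ Set.Icc s₁ s₀] s] fun t => s - t := by
      have h3 : Tendsto (fun t : ℝ => s - t) (𝓝[T ∩ Set.Icc s₁ s₀] s) (𝓝 0) := by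
        have : Continuous fun t : ℝ => s - t := by fun_prop
        have := this.tendsto s
        rw [sub_self] at this
        exact this.mono_left nhdsWithin_le_nhds
      have h4 := (Asymptotics.isLittleO_one_iff ℝ).2 h3
      have h5 := h4.mul_isBigO (Asymptotics.isBigO_refl (fun t : ℝ => s - t) _)
      simpa [pow_two] using h5
    have hint : (fun t => (∫ r in t..s, β r) - (s - t) • β s)
        =o[𝓝[T ∩ Set.Icc s₁ s₀] s] fun t => s - t := by
      have h3 := (hβ.integral_hasStrictDerivAt s s).hasDerivAt
      rw [hasDerivAt_iff_isLittleO] at h3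
      have h4 := ((h3.mono (nhdsWithin_le_nhds (s := T ∩ Set.Icc s₁ s₀))).neg_right).neg_left
      refine (h4.congr_left fun t => ?_).congr_right fun t => neg_sub _ _
      rw [intervalIntegral.integral_same, intervalIntegral.integral_symm s t,
        ← neg_sub s t, neg_smul]
      abel
    refine ((hquad.trans_isLittleO hsq).add hint).congr_left fun t => ?_
    rw [smul_add]
    abel
  · have hr : rho T s ∈ T := rho_mem hT hs
    have hr₁ : s₁ ≤ rho T s := le_rho hs₁ h1
    have hrho := rho_inter_Icc hs₁ h1 h2
    refine hasNablaDeriv_of_gap (hrho ▸ hgap) (hcont s ⟨hs, h1.le, h2⟩) ?_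
    rw [hrho, smul_add, smul_gapAverage hgap, hy,
      h.forcedResponse_eq hT hβ hr hs hgap.le h2, h.gap _ hr s hs hgap (gap_rho T s),
      sub_mulVec, one_mulVec, smul_mulVec]
    -- On the gap `rho T r` is constantly `rho T s`, so the kernel is `1` and the gap average of `β`
    -- is exactly the forcing required.
    have : ∫ r in rho T s..s, Φ (rho T s) (rho T r) *ᵥ β r = ∫ r in rho T s..s, β r := by
      refine intervalIntegral.integral_congr_ae (Eventually.of_forall fun r hr' => ?_)
      rw [Set.uIoc_of_le hgap.le] at hr'
      have h3 : rho T r = rho T s := by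
        refine rho_of_gap hr hr'.1 ?_
        have := gap_rho T s
        rw [Set.eq_empty_iff_forall_notMem] at this ⊢
        exact fun t ht => this t ⟨ht.1, ht.2.1, ht.2.2.trans_le hr'.2⟩
      rw [h3, h.one _ hr, one_mulVec]
    rw [this]
    abel

theorem gapAverage_mulVec (B : Matrix (Fin n) (Fin m) ℝ) {g : ℝ → Fin m → ℝ} (hg : Continuous g)
    (z : ℝ) : gapAverage T (fun r => B *ᵥ g r) z = B *ᵥ gapAverage T g z := by
  unfold gapAverage
  split_ifs with h
  · rw [mulVec_smul]
    congr 1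
    exact ContinuousLinearMap.intervalIntegral_comp_comm
      (LinearMap.toContinuousLinearMap B.mulVecLin) (hg.intervalIntegrable _ _)
  · rfl

/-- For a controllable pair, the forced response takes every value at `s₁`. -/
theorem IsCocycle.exists_input (hT : IsClosed T) (h : IsCocycle T A Φ) (hs₁ : s₁ ∈ T)
    (hlt : s₁ < s₀) {B : Matrix (Fin n) (Fin m) ℝ} (hAB : ControllablePair A B)
    (hcard : (n : ℕ∞) ≤ (T ∩ Set.Ico s₁ s₀).encard) (z : Fin n → ℝ) :
    ∃ g : ℝ → Fin m → ℝ, Continuous g ∧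
      ∫ r in s₁..s₀, Φ s₁ (rho T r) *ᵥ (B *ᵥ g r) = z := by
  have hint : ∀ g : ℝ → Fin m → ℝ, Continuous g →
      IntervalIntegrable (fun r => Φ s₁ (rho T r) *ᵥ (B *ᵥ g r)) volume s₁ s₀ := fun g hg =>
    h.intervalIntegrable hT hs₁ hlt.le ((continuous_mulVec_const B).comp hg)
  let V : Submodule ℝ (Fin n → ℝ) :=
    { carrier := {z | ∃ g : ℝ → Fin m → ℝ, Continuous g ∧
        ∫ r in s₁..s₀, Φ s₁ (rho T r) *ᵥ (B *ᵥ g r) = z}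
      zero_mem' := ⟨fun _ => 0, continuous_const, by simp⟩
      add_mem' := by
        rintro _ _ ⟨g, hg, rfl⟩ ⟨g', hg', rfl⟩
        refine ⟨fun r => g r + g' r, hg.add hg', ?_⟩
        rw [← intervalIntegral.integral_add (hint g hg) (hint g' hg')]
        simp only [mulVec_add]
      smul_mem' := by
        rintro c _ ⟨g, hg, rfl⟩
        refine ⟨fun r => c • g r, hg.const_smul c, ?_⟩
        rw [← intervalIntegral.integral_smul]
        simp only [mulVec_smul] }
  suffices V = ⊤ from (this ▸ Submodule.mem_top : z ∈ V)
  refine eq_top_of_forall_dotProduct V fun x hx => ?_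
  have hae : ∀ᵐ r ∂(volume.restrict (Set.Ioc s₁ s₀)), ∀ j : Fin m,
      x ⬝ᵥ (Φ s₁ (rho T r) *ᵥ (B *ᵥ Pi.single j 1)) = 0 := by
    rw [ae_all_iff]
    intro j
    let φ : (Fin n → ℝ) →L[ℝ] ℝ := LinearMap.toContinuousLinearMap (dotProductBilin ℝ ℝ x)
    have hφ : ∀ y, φ y = x ⬝ᵥ y := fun y => rfl
    have hj := hint (fun _ => Pi.single j 1) continuous_const
    rw [intervalIntegrable_iff_integrableOn_Ioc_of_le hlt.le] at hj
    -- Fundamental lemma of the calculus of variations: a covector orthogonal to all attainable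
    -- values annihilates the kernel almost everywhere, hence on a dense set, and `rho` of that set
    -- approximates each `r` from the right.
    refine ae_eq_zero_of_integral_contDiff_smul_eq_zero (φ.integrable_comp hj).locallyIntegrable
      fun g hg _ => ?_
    have hgc : Continuous fun r => g r • (Pi.single j 1 : Fin m → ℝ) :=
      hg.continuous.smul continuous_const
    have h1 := hx _ ⟨_, hgc, rfl⟩
    rw [← hφ, ← φ.intervalIntegral_comp_comm (hint _ hgc),
      intervalIntegral.integral_of_le hlt.le] at h1
    simpa only [mulVec_smul, dotProduct_smul, hφ] using h1
  rw [ae_restrict_iff' measurableSet_Ioc] at hae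
  have hdense := Measure.dense_of_ae hae
  refine h.eq_zero_of_controllablePair hT hs₁ hAB hcard fun r hr h1 h2 ε hε => ?_
  obtain ⟨q, hq, hqP⟩ := hdense.exists_mem_open isOpen_Ioo
    (Set.nonempty_Ioo.2 (lt_min h2 (lt_add_of_pos_right r hε)))
  have hqs : q < s₀ := hqP.2.trans_le (min_le_left _ _)
  have hqε : q < r + ε := hqP.2.trans_le (min_le_right _ _)
  refine ⟨rho T q, rho_mem_of_lt hT hr hqP.1, le_rho hr hqP.1, (rho_le T q).trans_lt hqε, ?_⟩
  ext j
  have h3 := hq ⟨h1.trans_lt hqP.1, hqs.le⟩ j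
  rw [mulVec_mulVec, dotProduct_mulVec] at h3
  simpa using h3

theorem controllableOn_of_controllablePair (hT : IsClosed T)
    {B : Matrix (Fin n) (Fin m) ℝ} {C : Matrix (Fin p) (Fin n) ℝ}
    (hΨ : IsTransitionMatrix T (fun _ => A) Φ) (hs₁ : s₁ ∈ T) (hs₀ : s₀ ∈ T) (hlt : s₁ < s₀)
    (hAB : ControllablePair A B) (hcard : (n : ℕ∞) ≤ (T ∩ Set.Ico s₁ s₀).encard) :
    ControllableOn T (LinSystem.const A B C) s₁ s₀ := by
  intro y₀ y₁
  have h := hΨ.isCocycle hT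
  -- The forced response carries a minus sign, so the integral must equal the free motion minus the
  -- target.
  obtain ⟨g, hg, hgz⟩ := h.exists_input hT hs₁ hlt hAB hcard (Φ s₁ s₀ *ᵥ y₀ - y₁)
  have hβ : Continuous fun r => B *ᵥ g r := (continuous_mulVec_const B).comp hg
  obtain ⟨hc, hd⟩ := h.forcedResponse_isSolution hT hβ hs₁ hs₀ hlt.le
  refine ⟨gapAverage T g, fun s => Φ s s₀ *ᵥ y₀ + forcedResponse T Φ s₀ (fun r => B *ᵥ g r) s,
    piecewiseLdContinuous_gapAverage hg hs₁,
    ⟨(hΨ.continuousOn_mulVec hs₀ y₀ s₁ le_rfl).add hc, fun s hs h1 h2 _ => ?_⟩, ?_, ?_⟩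
  · refine ((hΨ.hasNablaDeriv_mulVec hs₀ y₀ hs₁ le_rfl hs h1 h2).add
      (hd s hs h1 h2)).congr_deriv ?_
    simp only [LinSystem.const]
    rw [gapAverage_mulVec B hg, mulVec_add]
    abel
  · simp [forcedResponse, h.one s₀ hs₀]
  · simp only [forcedResponse, hgz]
    abel

end Steering

end NablaControl

open NablaControl in
theorem theorem6p6 (T : Set ℝ) (hT : IsClosed T) (n m p : ℕ)
    (hcard : ((max 2 (2 * n) : ℕ) : ℕ∞) ≤ T.encard)
    (A : Matrix (Fin n) (Fin n) ℝ) (B : Matrix (Fin n) (Fin m) ℝ) (C : Matrix (Fin p) (Fin n) ℝ)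
    (G : ℝ → ℝ → Matrix (Fin p) (Fin m) ℝ)
    (hG : IsRealization T (LinSystem.const A B C) G) :
    (IsMinimalRealization T (LinSystem.const A B C) G ↔
      ∃ s₀ ∈ T, ∃ s₁ ∈ T, s₁ < s₀ ∧
        ControllableOn T (LinSystem.const A B C) s₁ s₀ ∧
        ObservableOn T (LinSystem.const A B C) s₁ s₀) ∧
    (IsMinimalTimeInvariantRealization T (LinSystem.const A B C) G ↔
      ∃ s₀ ∈ T, ∃ s₁ ∈ T, s₁ < s₀ ∧
        ControllableOn T (LinSystem.const A B C) s₁ s₀ ∧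
        ObservableOn T (LinSystem.const A B C) s₁ s₀) := by
  obtain ⟨-, Ψ, hΨ, -⟩ := id hG
  have weaken : IsMinimalRealization T (LinSystem.const A B C) G →
      IsMinimalTimeInvariantRealization T (LinSystem.const A B C) G :=
    fun h => ⟨h.1, fun n' hn' ⟨A', B', C', h'⟩ => h.2 n' hn' ⟨_, h'⟩⟩
  have forward : IsMinimalTimeInvariantRealization T (LinSystem.const A B C) G →
      ∃ s₀ ∈ T, ∃ s₁ ∈ T, s₁ < s₀ ∧
        ControllableOn T (LinSystem.const A B C) s₁ s₀ ∧
        ObservableOn T (LinSystem.const A B C) s₁ s₀ := by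
    intro hmin
    have hAB : ControllablePair A B := by
      by_contra h
      obtain ⟨n', hn', h'⟩ := exists_smaller_of_not_controllablePair hT hG h
      exact hmin.2 n' hn' h'
    have hAC : ObservablePair A C := by
      by_contra h
      obtain ⟨n', hn', h'⟩ := exists_smaller_of_not_observablePair hT hG h
      exact hmin.2 n' hn' h'
    obtain ⟨s₀, hs₀, s₁, hs₁, hlt, h1, h2⟩ := exists_long_interval hcard
    exact ⟨s₀, hs₀, s₁, hs₁, hlt,
      controllableOn_of_controllablePair hT hΨ hs₁ hs₀ hlt hAB h2,
      observableOn_of_observablePair hΨ hT hs₀ hs₁ h1 hAC⟩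
  have backward : (∃ s₀ ∈ T, ∃ s₁ ∈ T, s₁ < s₀ ∧
        ControllableOn T (LinSystem.const A B C) s₁ s₀ ∧
        ObservableOn T (LinSystem.const A B C) s₁ s₀) →
      IsMinimalRealization T (LinSystem.const A B C) G := by
    rintro ⟨s₀, hs₀, s₁, hs₁, hlt, hctr, hobs⟩
    refine ⟨hG, fun n' hn' ⟨Λ', hΛ'⟩ => absurd hn' (not_lt.2 ?_)⟩
    exact dimension_le_of_isRealization hT
      (le_trans (by exact_mod_cast le_max_right 2 (2 * n)) hcard) hG
      (controllablePair_of_controllableOn hT hs₀ hs₁ hlt hctr)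
      (observablePair_of_observableOn hΨ hT hs₀ hs₁ hobs) hΛ'
  exact ⟨⟨fun h => forward (weaken h), backward⟩,
    ⟨forward, fun h => weaken (backward h)⟩⟩
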